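/- For $b>0$ and an entire function $f$ put $\|f\|_b=\sup_{k\ge 0} b^{-k}|f^{(k)}(0)|$, and for $a\ge 0$ let $\mathcal A_a$ be the Fréchet space of all entire $f$ with $\|f\|_b<\infty$ for every $b>a$, topologized by these norms. Let $\mathcal L_0$ (respectively $\mathcal L^-$) be the set of all functions $$f(z)=Cz^l e^{\alpha z}\prod_{j\ge1}(1+\beta_j z),\qquad C\in\mathbb C,\ l\in\mathbb N_0,\ \beta_1\ge\beta_2\ge\dots\ge 0,\ \sum_j\beta_j<\infty,$$ with $\alpha=0$ (respectively $\alpha<0$). For $\theta\ge0$ let $\Delta_\theta=(\theta+zD)D$, $D=d/dz$, and $w_\theta(z)=\sum_{k\ge0} z^k/(k!\,\Gamma(\theta+k))$, where $1/\Gamma(0)=0$. For entire functions $\varphi$ and $f$, $\varphi(\Delta_\theta)f$ is defined by the double series $$\sum_{k,m\ge0}\frac{\varphi^{(k)}(0)}{k!}\,\frac{f^{(m)}(0)}{m!}\,\Delta_\theta^k z^m .$$ **Theorem.** Let $\theta\ge 0$, $\varepsilon\ge 0$ and $g(z)=e^{-\varepsilon z}h(z)$ with $h\in\mathcal A_0$.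 For $t>0$ and $z\in\mathbb C$ put $$f(t,z)=e^{-z/t}\Big(\int_0^\infty s^{\theta-1}w_\theta\big(\tfrac{zs}{t}\big)e^{-s}g(ts)\,ds+\delta_{\theta,0}\,g(0)\Big),$$ where $\delta_{\theta,0}$ is $1$ for $\theta=0$ and $0$ for $\theta>0$, and put $f(0,z)=g(z)$. The integral converges absolutely. For $0\le t$ with $t\varepsilon<1$ the double series of $\exp(t\Delta_\theta)g$ converges absolutely and $f(t,z)=(\exp(t\Delta_\theta)g)(z)$; for the other $t$ the formula for $f(t,\cdot)$ serves as the definition of $\exp(t\Delta_\theta)g$. (i) For every $t\ge0$, $f(t,\cdot)\in\mathcal A_\varepsilon$, and $f$ solves $$\frac{\partial f}{\partial t}=\theta\frac{\partial f}{\partial z}+z\frac{\partial^2 f}{\partial z^2}\quad(t\ge0,\ z\in\mathbb C),\qquad f(0,\cdot)=g,$$ where the derivative in $t$ (one-sided at $t=0$) exists pointwise and also in the topology of $\mathcal A_\varepsilon$. (ii) If $\varepsilon>0$, and if $\theta>0$ or $g(0)=0$, then $f(t,\cdot)\to0$ uniformly on compact subsets of $\mathbb C$ as $t\to+\infty$.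 (iii) If $h\in\mathcal L_0$, then for every $t\ge0$ the function $f(t,\cdot)$ belongs to $\mathcal L_0$ when $\varepsilon=0$ and to $\mathcal L^-$ when $\varepsilon>0$. -/

import Mathlib

/-- The norm `‖f‖_b = sup_k b^{-k} |f^{(k)}(0)|` (possibly `∞`), for `b > 0`. -/
noncomputable def expTypeNorm (b : ℝ) (f : ℂ → ℂ) : ENNReal :=
  ⨆ k : ℕ, ENNReal.ofReal (‖iteratedDeriv k f 0‖ / b ^ k)

/-- The space `B_b` of the entire functions with `‖f‖_b < ∞`, for `b > 0`. -/
def spaceB (b : ℝ) : Set (ℂ → ℂ) :=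
  {f | Differentiable ℂ f ∧ expTypeNorm b f < ⊤}

/-- The space `A_a = ⋂_{b > a} B_b`, for `a ≥ 0`. -/
def spaceA (a : ℝ) : Set (ℂ → ℂ) :=
  ⋂ b ∈ Set.Ioi a, spaceB b

/-- `f` has the representation `f z = C z^l exp (α z) ∏_j (1 + β_j z)` with `C ∈ ℂ`, `l ∈ ℕ₀`,
`β_0 ≥ β_1 ≥ … ≥ 0` and `∑ β_j < ∞` (so that the product converges absolutely). -/
def HasLaguerreRep (α : ℝ) (f : ℂ → ℂ) : Prop :=
  ∃ (C : ℂ) (l : ℕ) (β : ℕ → ℝ), Antitone β ∧ (∀ j, 0 ≤ β j) ∧ Summable β ∧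
    ∀ z : ℂ, f z = C * z ^ l * Complex.exp ((α : ℂ) * z) * ∏' j : ℕ, (1 + (β j : ℂ) * z)

/-- The family `L_0`: the representation holds with `α = 0`. -/
def familyLZero : Set (ℂ → ℂ) := {f | HasLaguerreRep 0 f}

/-- The family `L⁻`: the representation holds with some `α < 0`. -/
def familyLMinus : Set (ℂ → ℂ) := {f | ∃ α : ℝ, α < 0 ∧ HasLaguerreRep α f}

/-- The operator `Δ_θ = (θ + z D) D`. -/
noncomputable def deltaOp (θ : ℝ) (f : ℂ → ℂ) : ℂ → ℂ :=
  fun z => (θ : ℂ) * deriv f z + z * deriv (deriv f) z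

/-- The terms of the double series that defines `φ(Δ_θ) f` at `z`:
`(φ^{(k)}(0) / k!) (f^{(m)}(0) / m!) (Δ_θ^k z^m)`. -/
noncomputable def opSeriesTerm (θ : ℝ) (φ f : ℂ → ℂ) (z : ℂ) (p : ℕ × ℕ) : ℂ :=
  (iteratedDeriv p.1 φ 0 / (p.1.factorial : ℂ)) * (iteratedDeriv p.2 f 0 / (p.2.factorial : ℂ)) *
    ((deltaOp θ)^[p.1] (fun w : ℂ => w ^ p.2)) z

/-- `γ_θ(m) = m! Γ(θ + m)`. -/
noncomputable def gammaTheta (θ : ℝ) (m : ℕ) : ℝ :=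
  (m.factorial : ℝ) * Real.Gamma (θ + m)

/-- `w_θ(z) = ∑_k z^k / γ_θ(k)`. For `θ = 0` the term with `k = 0` is `0`, in accordance with
`1 / Γ(0) = 0` (in Mathlib `Real.Gamma 0 = 0` and division by `0` gives `0`). -/
noncomputable def wTheta (θ : ℝ) (z : ℂ) : ℂ :=
  ∑' k : ℕ, z ^ k / (gammaTheta θ k : ℂ)

/-- The integrand `s^{θ-1} w_θ(z s / t) e^{-s} g(t s)`. -/
noncomputable def expDeltaIntegrand (θ : ℝ) (g : ℂ → ℂ) (t : ℝ) (z : ℂ) (s : ℝ) : ℂ :=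
  ((s ^ (θ - 1) : ℝ) : ℂ) * wTheta θ (z * s / t) * (Real.exp (-s) : ℂ) * g ((t * s : ℝ) : ℂ)

/-- The (extended) operator `exp(t Δ_θ)`, `t ≥ 0`: the identity for `t = 0`, and for `t > 0` the
integral operator
`e^{-z/t} ∫_0^∞ s^{θ-1} w_θ(z s / t) e^{-s} g(t s) ds`.
In `s^{θ-1} w_θ(z s / t) e^{-s} ds` the term of `w_θ` with `k = 0` gives the probability measure
`s^{θ-1} e^{-s} ds / Γ(θ)`; as `θ → 0+` this tends to the unit mass at `s = 0`, hence the
summand `g(0)` for `θ = 0`. -/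
noncomputable def expDelta (θ t : ℝ) (g : ℂ → ℂ) : ℂ → ℂ := fun z =>
  if t = 0 then g z
  else Complex.exp (-z / t) *
    ((∫ s in Set.Ioi (0 : ℝ), expDeltaIntegrand θ g t z s) + (if θ = 0 then g 0 else 0))

/-! An entire function is handled through the sequence c of its derivatives at 0. Membership in
`spaceA a` becomes `‖c k‖ ≤ K b ^ k` for every b > a, and Δ_θ becomes the weighted shift with
entries (θ + k) c_{k+1} (`EgfSummable.deltaOp_egf`). Hence exp(τ Δ_θ) should send a to the sequence
Σ_k (θ + j)_k a_{j+k} τ^k / k! (`heatCoeff`), whose convergence and growth follow by comparison with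
negative binomial series.

The integral formula is the same series. Termwise integration produces Γ(θ + j + m) / Γ(θ + j) = (θ
+ j)_m, and Kummer's transformation (`hasSum_poch_exp`) extracts a factor e^{z/t}, which the
prefactor e^{-z/t} cancels; this is `hasSum_heatTerm_expDelta`.

Rescaling s in the integral absorbs an exponential factor of g: with A = 1 / (1 + ε t), the function
exp(t Δ_θ)(e^{-εz} h) at z equals A^θ e^{-εAz} times exp(tA Δ_θ) h at A² z (`expDelta_exp_mul`). As
h has type zero, its double series converges at every time tA, so everything reduces to h. The
derivatives at 0 satisfy c_k' = (θ + k) c_{k+1} (`MinType.hasDerivAt_flowCoeff`); a Taylor estimate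
uniform in k, at the price of slightly enlarging b, gives the derivative in each norm and pointwise.
As t → ∞, tA stays bounded while A → 0, which gives the decay.

For the Laguerre families, p + a Δ_θ p has only nonpositive roots when p does
(`NonposRooted.add_deltaPoly`): off the real axis the imaginary parts of p / p' and z p'' / p'
cannot cancel. So Euler's approximants (1 + τ Δ_θ / n)^n, applied to partial products of h, are such
polynomials, and they tend to exp(τ Δ_θ) h (`tendsto_eval_one_add_pow`). Compactness of the
reciprocal roots shows that the limit is e^{αz}, α ≥ 0, times a Laguerre product
(`exists_factorization_of_tendsto`), and type zero forces α = 0. -/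

open Filter Topology Finset

/-! ### Exponential generating functions -/

/-- The exponential generating function of a sequence. -/
noncomputable def egf (c : ℕ → ℂ) (z : ℂ) : ℂ := ∑' j : ℕ, c j * z ^ j / (j.factorial : ℂ)

/-- The exponential generating function converges absolutely everywhere. -/
def EgfSummable (c : ℕ → ℂ) : Prop :=
  ∀ R : ℝ, 0 ≤ R → Summable fun k : ℕ => ‖c k‖ * R ^ k / (k.factorial : ℝ)

theorem norm_egf_term (c : ℕ → ℂ) (z : ℂ) (j : ℕ) :
    ‖c j * z ^ j / (j.factorial : ℂ)‖ = ‖c j‖ * ‖z‖ ^ j / (j.factorial : ℝ) := by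
  simp

theorem EgfSummable.summable {c : ℕ → ℂ} (hc : EgfSummable c) (z : ℂ) :
    Summable fun j : ℕ => c j * z ^ j / (j.factorial : ℂ) := by
  apply Summable.of_norm
  simpa only [norm_egf_term] using hc ‖z‖ (norm_nonneg z)

theorem EgfSummable.hasSum {c : ℕ → ℂ} (hc : EgfSummable c) (z : ℂ) :
    HasSum (fun j : ℕ => c j * z ^ j / (j.factorial : ℂ)) (egf c z) :=
  (hc.summable z).hasSum

/-- Doubling the radius pays for the factor `k` produced by differentiation; `R + 1` in place of `R`
keeps the bound valid for `R < 1`. -/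
theorem EgfSummable.shift_aux {c : ℕ → ℂ} {R : ℝ} (hR : 0 ≤ R) (k : ℕ) :
    ‖c k‖ * (k * R ^ (k - 1)) / (k.factorial : ℝ) ≤
      ‖c k‖ * (2 * (R + 1)) ^ k / (k.factorial : ℝ) := by
  have h1 : (k : ℝ) ≤ 2 ^ k := by exact_mod_cast (Nat.lt_two_pow_self).le
  have h2 : R ^ (k - 1) ≤ (R + 1) ^ k := by
    calc R ^ (k - 1) ≤ (R + 1) ^ (k - 1) := by gcongr; linarith
      _ ≤ (R + 1) ^ k := pow_le_pow_right₀ (by linarith) (Nat.sub_le _ _)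
  rw [mul_pow]
  gcongr

theorem EgfSummable.shift {c : ℕ → ℂ} (hc : EgfSummable c) :
    EgfSummable fun k => c (k + 1) := by
  intro R hR
  have h := (summable_nat_add_iff 1).2 (hc (2 * (R + 1)) (by positivity))
  refine Summable.of_nonneg_of_le (fun k => by positivity) (fun k => ?_) h
  refine le_trans (le_of_eq ?_) (EgfSummable.shift_aux hR (k + 1))
  rw [Nat.factorial_succ, Nat.add_sub_cancel]
  push_cast
  field_simp

theorem EgfSummable.hasDerivAt {c : ℕ → ℂ} (hc : EgfSummable c) (z : ℂ) :
    HasDerivAt (egf c) (egf (fun k => c (k + 1)) z) z := by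
  set R : ℝ := ‖z‖ + 1 with hRdef
  have hR : 0 ≤ R := by positivity
  have hu : Summable fun k : ℕ => ‖c k‖ * (k * R ^ (k - 1)) / (k.factorial : ℝ) :=
    Summable.of_nonneg_of_le (fun k => by positivity) (fun k => EgfSummable.shift_aux hR k)
      (hc (2 * (R + 1)) (by positivity))
  have hz : z ∈ Metric.ball (0 : ℂ) R := by simp [hRdef]
  have key := hasDerivAt_tsum_of_isPreconnected (𝕜 := ℂ)
    (g := fun (k : ℕ) (w : ℂ) => c k * w ^ k / (k.factorial : ℂ))
    (g' := fun (k : ℕ) (w : ℂ) => c k * (k * w ^ (k - 1)) / (k.factorial : ℂ))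
    (t := Metric.ball (0 : ℂ) R) (y₀ := z) (y := z) hu Metric.isOpen_ball
    (convex_ball _ _).isPreconnected
    (fun k w _ => ((hasDerivAt_pow k w).const_mul (c k)).div_const _)
    (fun k w hw => by
      have hw' : ‖w‖ ≤ R := by simpa using (mem_ball_zero_iff.1 hw).le
      simp only [norm_div, norm_mul, norm_pow, Complex.norm_natCast]
      gcongr)
    hz (hc.summable z) hz
  have hval : (∑' k : ℕ, c k * (k * z ^ (k - 1)) / (k.factorial : ℂ)) =
      egf (fun k => c (k + 1)) z := by
    have hs : HasSum (fun k : ℕ => c (k + 1) * (((k + 1 : ℕ) : ℂ) * z ^ (k + 1 - 1)) /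
        ((k + 1).factorial : ℂ)) (egf (fun k => c (k + 1)) z) := by
      convert hc.shift.hasSum z using 2 with k
      rw [Nat.factorial_succ, Nat.add_sub_cancel]
      have : ((k : ℂ) + 1) ≠ 0 := by exact_mod_cast Nat.succ_ne_zero k
      push_cast
      field_simp
    refine HasSum.tsum_eq ?_
    have := (hasSum_nat_add_iff (f := fun k : ℕ => c k * (k * z ^ (k - 1)) / (k.factorial : ℂ))
      1).1 hs
    simpa using this
  rw [hval] at key
  exact key

theorem EgfSummable.differentiable {c : ℕ → ℂ} (hc : EgfSummable c) :
    Differentiable ℂ (egf c) := fun z => (hc.hasDerivAt z).differentiableAt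

theorem EgfSummable.deriv {c : ℕ → ℂ} (hc : EgfSummable c) :
    deriv (egf c) = egf (fun k => c (k + 1)) := funext fun z => (hc.hasDerivAt z).deriv

theorem egf_zero (c : ℕ → ℂ) : egf c 0 = c 0 := by
  unfold egf
  rw [tsum_eq_single 0]
  · simp
  · intro k hk
    simp [hk]

theorem EgfSummable.iteratedDeriv_zero {c : ℕ → ℂ} (hc : EgfSummable c) (k : ℕ) :
    iteratedDeriv k (egf c) 0 = c k := by
  induction k generalizing c with
  | zero => simp [egf_zero]
  | succ k ih => rw [iteratedDeriv_succ', hc.deriv, ih hc.shift]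

theorem hasSum_egf_of_differentiable {f : ℂ → ℂ} (hf : Differentiable ℂ f) (z : ℂ) :
    HasSum (fun j : ℕ => iteratedDeriv j f 0 * z ^ j / (j.factorial : ℂ)) (f z) := by
  refine (Complex.hasSum_taylorSeries_of_entire hf 0 z).congr_fun fun j => ?_
  simp only [smul_eq_mul, sub_zero]
  ring

theorem eq_egf_of_differentiable {f : ℂ → ℂ} (hf : Differentiable ℂ f) :
    f = egf fun j => iteratedDeriv j f 0 :=
  funext fun z => (hasSum_egf_of_differentiable hf z).tsum_eq.symm

theorem hasSum_exp_real (x : ℝ) : HasSum (fun j : ℕ => x ^ j / (j.factorial : ℝ)) (Real.exp x) := by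
  rw [Real.exp_eq_exp_ℝ]
  exact NormedSpace.expSeries_div_hasSum_exp x

theorem hasSum_exp_complex (x : ℂ) :
    HasSum (fun j : ℕ => x ^ j / (j.factorial : ℂ)) (Complex.exp x) := by
  rw [Complex.exp_eq_exp_ℂ]
  exact NormedSpace.expSeries_div_hasSum_exp x

/-! ### Geometric growth of coefficients and the spaces `spaceA` -/

/-- The sequence grows at most like `K b ^ j`. -/
def GeomBound (K b : ℝ) (c : ℕ → ℂ) : Prop := ∀ j, ‖c j‖ ≤ K * b ^ j

theorem GeomBound.nonneg {K b : ℝ} {c : ℕ → ℂ} (h : GeomBound K b c) : 0 ≤ K := by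
  have := (norm_nonneg _).trans (h 0)
  simpa using this

theorem GeomBound.term_le {K b : ℝ} {c : ℕ → ℂ} (h : GeomBound K b c) {R : ℝ} (hR : 0 ≤ R)
    (j : ℕ) : ‖c j‖ * R ^ j / (j.factorial : ℝ) ≤ K * ((b * R) ^ j / (j.factorial : ℝ)) := by
  rw [mul_pow, ← mul_div_assoc, ← mul_assoc]
  gcongr
  exact h j

theorem GeomBound.egfSummable {K b : ℝ} {c : ℕ → ℂ} (h : GeomBound K b c) : EgfSummable c :=
  fun R hR => Summable.of_nonneg_of_le (fun k => by positivity) (fun k => h.term_le hR k)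
    ((hasSum_exp_real (b * R)).summable.mul_left K)

theorem GeomBound.norm_egf_le {K b : ℝ} {c : ℕ → ℂ} (h : GeomBound K b c) (z : ℂ) :
    ‖egf c z‖ ≤ K * Real.exp (b * ‖z‖) := by
  refine tsum_of_norm_bounded ((hasSum_exp_real (b * ‖z‖)).mul_left K) fun j => ?_
  rw [norm_egf_term]
  exact h.term_le (norm_nonneg z) j

theorem expTypeNorm_le_ofReal {b K : ℝ} (hb : 0 < b) {f : ℂ → ℂ}
    (h : GeomBound K b fun k => iteratedDeriv k f 0) : expTypeNorm b f ≤ ENNReal.ofReal K := by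
  refine iSup_le fun k => ENNReal.ofReal_le_ofReal ?_
  rw [div_le_iff₀ (by positivity)]
  exact h k

theorem exists_geomBound_of_mem_spaceB {b : ℝ} (hb : 0 < b) {f : ℂ → ℂ} (hf : f ∈ spaceB b) :
    ∃ K, GeomBound K b fun k => iteratedDeriv k f 0 := by
  refine ⟨(expTypeNorm b f).toReal, fun k => ?_⟩
  have h1 : ENNReal.ofReal (‖iteratedDeriv k f 0‖ / b ^ k) ≤ expTypeNorm b f :=
    le_iSup (fun k : ℕ => ENNReal.ofReal (‖iteratedDeriv k f 0‖ / b ^ k)) k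
  rw [← div_le_iff₀ (by positivity)]
  exact (ENNReal.ofReal_le_iff_le_toReal hf.2.ne).1 h1

theorem mem_spaceA_iff {a : ℝ} {f : ℂ → ℂ} : f ∈ spaceA a ↔ ∀ b, a < b → f ∈ spaceB b := by
  simp [spaceA]

theorem exists_geomBound_of_mem_spaceA {a b : ℝ} (ha : 0 ≤ a) (hb : a < b) {f : ℂ → ℂ}
    (hf : f ∈ spaceA a) : ∃ K, GeomBound K b fun k => iteratedDeriv k f 0 :=
  exists_geomBound_of_mem_spaceB (ha.trans_lt hb) (mem_spaceA_iff.1 hf b hb)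

theorem differentiable_of_mem_spaceA {a : ℝ} {f : ℂ → ℂ} (hf : f ∈ spaceA a) :
    Differentiable ℂ f := (mem_spaceA_iff.1 hf (a + 1) (by linarith)).1

theorem egf_mem_spaceA {a : ℝ} (ha : 0 ≤ a) {c : ℕ → ℂ}
    (h : ∀ b, a < b → ∃ K, GeomBound K b c) : egf c ∈ spaceA a := by
  refine mem_spaceA_iff.2 fun b hb => ?_
  obtain ⟨K, hK⟩ := h b hb
  refine ⟨hK.egfSummable.differentiable, lt_of_le_of_lt
    (expTypeNorm_le_ofReal (ha.trans_lt hb) (K := K) fun k => ?_) ENNReal.ofReal_lt_top⟩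
  simpa only [hK.egfSummable.iteratedDeriv_zero] using hK k

theorem norm_le_of_geomBound {f : ℂ → ℂ} (hf : Differentiable ℂ f) {K b : ℝ}
    (h : GeomBound K b fun k => iteratedDeriv k f 0) (z : ℂ) :
    ‖f z‖ ≤ K * Real.exp (b * ‖z‖) := by
  conv_lhs => rw [eq_egf_of_differentiable hf]
  exact h.norm_egf_le z

/-- The coefficients of `exp (a z) * egf d z`. -/
noncomputable def expConv (a : ℂ) (d : ℕ → ℂ) (k : ℕ) : ℂ :=
  ∑ j ∈ range (k + 1), (k.choose j : ℂ) * a ^ (k - j) * d j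

theorem exp_mul_egf (a : ℂ) {d : ℕ → ℂ} (hd : EgfSummable d) (z : ℂ) :
    Complex.exp (a * z) * egf d z = egf (expConv a d) z := by
  have h1 : Summable fun j : ℕ => ‖(a * z) ^ j / (j.factorial : ℂ)‖ :=
    (hasSum_exp_complex (a * z)).summable.norm
  have h2 : Summable fun j : ℕ => ‖d j * z ^ j / (j.factorial : ℂ)‖ := (hd.summable z).norm
  rw [← (hasSum_exp_complex (a * z)).tsum_eq, mul_comm]
  unfold egf
  rw [tsum_mul_tsum_eq_tsum_sum_range_of_summable_norm h2 h1]
  refine tsum_congr fun k => ?_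
  unfold expConv
  rw [sum_mul, sum_div]
  refine sum_congr rfl fun j hj => ?_
  have hjk : j ≤ k := Nat.lt_succ_iff.1 (mem_range.1 hj)
  have hz : z ^ k = z ^ j * z ^ (k - j) := by rw [← pow_add, Nat.add_sub_cancel' hjk]
  rw [Nat.cast_choose ℂ hjk, hz, mul_pow]
  have := Nat.cast_ne_zero (R := ℂ).2 (Nat.factorial_ne_zero k)
  field_simp

theorem GeomBound.expConv {K b : ℝ} {d : ℕ → ℂ} (h : GeomBound K b d) (a : ℂ) :
    GeomBound K (‖a‖ + b) (expConv a d) := by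
  intro k
  unfold _root_.expConv
  refine (norm_sum_le _ _).trans ?_
  rw [add_comm ‖a‖ b, add_pow, mul_sum]
  refine sum_le_sum fun j _ => ?_
  rw [norm_mul, norm_mul, norm_pow, Complex.norm_natCast]
  calc (k.choose j : ℝ) * ‖a‖ ^ (k - j) * ‖d j‖
      ≤ (k.choose j : ℝ) * ‖a‖ ^ (k - j) * (K * b ^ j) := by gcongr; exact h j
    _ = _ := by ring

/-! ### Rising products and negative binomial bounds -/

/-- The rising product `x (x + 1) ⋯ (x + k - 1)`. -/
noncomputable def poch (x : ℝ) (k : ℕ) : ℝ := ∏ i ∈ range k, (x + i)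

@[simp] theorem poch_zero (x : ℝ) : poch x 0 = 1 := by simp [poch]

theorem poch_succ (x : ℝ) (k : ℕ) : poch x (k + 1) = poch x k * (x + k) := prod_range_succ _ _

theorem poch_succ' (x : ℝ) (k : ℕ) : poch x (k + 1) = x * poch (x + 1) k := by
  unfold poch
  rw [prod_range_succ', mul_comm]
  congr 1
  · simp
  · refine prod_congr rfl fun i _ => ?_
    push_cast
    ring

theorem poch_nonneg {x : ℝ} (hx : 0 ≤ x) (k : ℕ) : 0 ≤ poch x k :=
  prod_nonneg fun _ _ => by positivity

theorem poch_zero_left {k : ℕ} (hk : k ≠ 0) : poch 0 k = 0 := by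
  obtain ⟨k, rfl⟩ := Nat.exists_eq_succ_of_ne_zero hk
  rw [Nat.succ_eq_add_one, poch_succ', zero_mul]

theorem Gamma_add_nat {x : ℝ} (hx : 0 < x) (m : ℕ) :
    Real.Gamma (x + m) = poch x m * Real.Gamma x := by
  induction m with
  | zero => simp
  | succ m ih =>
    have : x + ((m + 1 : ℕ) : ℝ) = (x + m) + 1 := by push_cast; ring
    rw [this, Real.Gamma_add_one (by positivity), ih, poch_succ]
    ring

/-- At integers the rising products are binomial coefficients. With monotonicity in the base this
bounds (x)_m / m! by a coefficient of (1 - y)^{-(N+1)}, which replaces the binomial series with real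
exponent wherever an upper bound is enough. -/
theorem poch_nat_succ (N m : ℕ) :
    poch ((N : ℝ) + 1) m = ((m + N).choose N : ℝ) * (m.factorial : ℝ) := by
  induction m with
  | zero => simp
  | succ m ih =>
    rw [poch_succ, ih, Nat.factorial_succ]
    have h := Nat.add_one_mul_choose_eq (m + N) m
    have e1 : (m + 1 + N).choose N = (m + N + 1).choose (m + 1) := by
      rw [← Nat.choose_symm_of_eq_add (by ring : m + N + 1 = N + (m + 1))]
      congr 1; ring
    have e2 : (m + N).choose N = (m + N).choose m := Nat.choose_symm_of_eq_add (by ring)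
    rw [e1, e2]
    have h' : ((m + N : ℕ) + 1 : ℝ) * ((m + N).choose m : ℝ) =
        ((m + N + 1).choose (m + 1) : ℝ) * ((m : ℝ) + 1) := by exact_mod_cast h
    push_cast at h' ⊢
    linear_combination (m.factorial : ℝ) * h'

theorem poch_mono {x y : ℝ} (hx : 0 ≤ x) (hxy : x ≤ y) (k : ℕ) : poch x k ≤ poch y k :=
  prod_le_prod (fun _ _ => by positivity) fun _ _ => by linarith

theorem poch_div_factorial_le {x : ℝ} {N : ℕ} (hx : 0 ≤ x) (hN : x ≤ N + 1) (m : ℕ) :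
    poch x m / (m.factorial : ℝ) ≤ ((m + N).choose N : ℝ) := by
  rw [div_le_iff₀ (by positivity), ← poch_nat_succ]
  exact poch_mono hx hN m

theorem hasSum_choose_mul_pow (N : ℕ) {y : ℝ} (hy : 0 ≤ y) (hy1 : y < 1) :
    HasSum (fun m : ℕ => ((m + N).choose N : ℝ) * y ^ m) ((1 / (1 - y)) ^ (N + 1)) := by
  have := hasSum_choose_mul_geometric_of_norm_lt_one (𝕜 := ℝ) N (r := y)
    (by rwa [Real.norm_eq_abs, abs_of_nonneg hy])
  simpa [one_div] using this

theorem poch_term_le {x : ℝ} {N : ℕ} (hx : 0 ≤ x) (hN : x ≤ N + 1) {y : ℝ} (hy : 0 ≤ y) (m : ℕ) :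
    poch x m * y ^ m / (m.factorial : ℝ) ≤ ((m + N).choose N : ℝ) * y ^ m := by
  rw [mul_div_right_comm]
  gcongr
  exact poch_div_factorial_le hx hN m

theorem poch_term_nonneg {x : ℝ} (hx : 0 ≤ x) {y : ℝ} (hy : 0 ≤ y) (m : ℕ) :
    0 ≤ poch x m * y ^ m / (m.factorial : ℝ) := by
  have := poch_nonneg hx m
  positivity

theorem summable_poch_pow {x : ℝ} (hx : 0 ≤ x) {y : ℝ} (hy : 0 ≤ y) (hy1 : y < 1) :
    Summable fun m : ℕ => poch x m * y ^ m / (m.factorial : ℝ) := by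
  have hN : x ≤ ⌈x⌉₊ + 1 := (Nat.le_ceil x).trans (by linarith)
  exact Summable.of_nonneg_of_le (poch_term_nonneg hx hy) (poch_term_le hx hN hy)
    (hasSum_choose_mul_pow _ hy hy1).summable

theorem tsum_poch_pow_le {x : ℝ} {N : ℕ} (hx : 0 ≤ x) (hN : x ≤ N + 1) {y : ℝ} (hy : 0 ≤ y)
    (hy1 : y < 1) :
    ∑' m : ℕ, poch x m * y ^ m / (m.factorial : ℝ) ≤ (1 / (1 - y)) ^ (N + 1) := by
  rw [← (hasSum_choose_mul_pow N hy hy1).tsum_eq]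
  exact (summable_poch_pow hx hy hy1).tsum_le_tsum (poch_term_le hx hN hy)
    (hasSum_choose_mul_pow N hy hy1).summable

/-- The integer majorant grows by exactly 1 with `j`, so the resulting bound (1 - y)^{-(⌈θ⌉ + j +
1)} is a constant times a `j`-th power. -/
theorem add_nat_le_ceil_add_nat (θ : ℝ) (j : ℕ) : θ + j ≤ ((⌈θ⌉₊ + j : ℕ) : ℝ) + 1 := by
  have := Nat.le_ceil θ
  push_cast
  linarith

/-- The inner sum over the second index is at most geometric in the first, so the outer sum is
dominated by an exponential series at X / (1 - y). All absolute convergence of double series below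
rests on this. -/
theorem summable_pow_mul_poch {θ : ℝ} (hθ : 0 ≤ θ) {X y : ℝ} (hX : 0 ≤ X) (hy : 0 ≤ y)
    (hy1 : y < 1) : Summable fun p : ℕ × ℕ =>
      X ^ p.1 / (p.1.factorial : ℝ) * (poch (θ + p.1) p.2 * y ^ p.2 / (p.2.factorial : ℝ)) := by
  have hj : ∀ j : ℕ, 0 ≤ θ + j := fun j => by positivity
  have hy' : 0 < 1 - y := by linarith
  have hterm : ∀ j m : ℕ, 0 ≤ poch (θ + j) m * y ^ m / (m.factorial : ℝ) :=
    fun j m => poch_term_nonneg (hj j) hy m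
  refine (summable_prod_of_nonneg fun p => mul_nonneg (by positivity) (hterm p.1 p.2)).2 ⟨?_, ?_⟩
  · intro j
    exact (summable_poch_pow (hj j) hy hy1).mul_left (X ^ j / (j.factorial : ℝ))
  · have h := (hasSum_exp_real (X * (1 / (1 - y)))).summable.mul_left
      ((1 / (1 - y)) ^ (⌈θ⌉₊ + 1))
    refine Summable.of_nonneg_of_le (fun j => ?_) (fun j => ?_) h
    · exact tsum_nonneg fun m => mul_nonneg (by positivity) (hterm j m)
    · have h2 := tsum_poch_pow_le (hj j) (add_nat_le_ceil_add_nat θ j) hy hy1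
      dsimp only
      rw [tsum_mul_left]
      calc _ ≤ X ^ j / (j.factorial : ℝ) * (1 / (1 - y)) ^ (⌈θ⌉₊ + j + 1) := by gcongr
        _ = _ := by rw [mul_pow]; ring

theorem succ_descFactorial_succ_add (j i : ℕ) :
    (j + 1).descFactorial (i + 1) = j.descFactorial (i + 1) + (i + 1) * j.descFactorial i := by
  rw [Nat.succ_descFactorial_succ, Nat.descFactorial_succ, ← add_mul]
  rcases le_or_gt i j with h | h
  · congr 1; omega
  · rw [Nat.descFactorial_of_lt h]; simp

theorem poch_add_one_eq (x : ℝ) (r : ℕ) :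
    poch (x + 1) (r + 1) = poch x (r + 1) + (r + 1) * poch (x + 1) r := by
  rw [poch_succ, poch_succ']
  ring

/-- The Chu–Vandermonde expansion of `poch (θ + j) m` in falling factorials of `j`. -/
theorem poch_add_nat_eq_sum (θ : ℝ) (j m : ℕ) :
    poch (θ + j) m =
      ∑ i ∈ range (m + 1), (m.choose i : ℝ) * poch (θ + i) (m - i) * (j.descFactorial i : ℝ) := by
  induction j generalizing θ with
  | zero =>
    rw [sum_eq_single 0]
    · simp
    · intro i _ hi
      obtain ⟨i, rfl⟩ := Nat.exists_eq_succ_of_ne_zero hi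
      simp
    · simp
  | succ j ih =>
    -- The unit is moved from `j` to `θ`, and the induction hypothesis is used at `θ + 1`. Comparing
    -- coefficients of the falling factorials of `j` then leaves one identity, a consequence of
    -- `poch_add_one_eq`.
    have h0 : θ + ((j + 1 : ℕ) : ℝ) = (θ + 1) + j := by push_cast; ring
    rw [h0, ih]
    -- The truncated index `i - 1` at `i = 0` is harmless, since its factor `i` vanishes.
    have hstep : ∀ i : ℕ, ((j + 1).descFactorial i : ℝ) = (j.descFactorial i : ℝ) +
        (i : ℝ) * (j.descFactorial (i - 1) : ℝ) := by
      intro i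
      cases i with
      | zero => simp
      | succ i =>
        rw [succ_descFactorial_succ_add]
        push_cast
        simp
    simp only [hstep, mul_add, sum_add_distrib]
    rw [sum_range_succ' (fun i : ℕ => (m.choose i : ℝ) * poch (θ + i) (m - i) *
      ((i : ℝ) * (j.descFactorial (i - 1) : ℝ)))]
    rw [sum_range_succ, sum_range_succ (n := m)]
    simp only [Nat.cast_zero, zero_mul, mul_zero, add_zero, Nat.choose_self, Nat.sub_self,
      poch_zero]
    rw [add_right_comm, ← sum_add_distrib]
    congr 1
    refine sum_congr rfl fun i hi => ?_
    have him : i < m := mem_range.1 hi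
    obtain ⟨r, rfl⟩ : ∃ r, m = i + (r + 1) := ⟨m - i - 1, by omega⟩
    have e1 : i + (r + 1) - i = r + 1 := by omega
    have e2 : i + (r + 1) - (i + 1) = r := by omega
    have hc : ((i + (r + 1)).choose (i + 1) : ℝ) * ((i : ℝ) + 1) =
        ((i + (r + 1)).choose i : ℝ) * ((r : ℝ) + 1) := by
      have := Nat.choose_succ_right_eq (i + (r + 1)) i
      rw [e1] at this
      exact_mod_cast this
    rw [e1, e2, Nat.add_sub_cancel]
    have hx1 : θ + 1 + (i : ℝ) = (θ + i) + 1 := by ring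
    have hx2 : θ + ((i + 1 : ℕ) : ℝ) = (θ + i) + 1 := by push_cast; ring
    rw [hx1, hx2, poch_add_one_eq (θ + i) r]
    push_cast
    linear_combination -(poch (θ + i + 1) r * (j.descFactorial i : ℝ)) * hc

/-! ### Coefficients of the flow on functions of type zero -/

/-- The coefficient sequence of order zero growth: `‖a j‖ ≤ K b ^ j` for every `b > 0`. -/
def MinType (a : ℕ → ℂ) : Prop := ∀ b : ℝ, 0 < b → ∃ K, GeomBound K b a

/-- The `j`-th derivative at `0` of `exp (τ Δ_θ) (egf a)`. -/
noncomputable def heatCoeff (θ : ℝ) (a : ℕ → ℂ) (j : ℕ) (τ : ℂ) : ℂ :=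
  egf (fun k => (poch (θ + j) k : ℂ) * a (j + k)) τ

theorem GeomBound.heat_term_le {θ : ℝ} (hθ : 0 ≤ θ) {K b : ℝ} {a : ℕ → ℂ} (h : GeomBound K b a)
    {R : ℝ} (hR : 0 ≤ R) (j k : ℕ) :
    ‖(poch (θ + j) k : ℂ) * a (j + k)‖ * R ^ k / (k.factorial : ℝ) ≤
      K * b ^ j * (poch (θ + j) k * (b * R) ^ k / (k.factorial : ℝ)) := by
  have hp : 0 ≤ poch (θ + j) k := poch_nonneg (by positivity) k
  rw [norm_mul, Complex.norm_real, Real.norm_of_nonneg hp]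
  calc poch (θ + j) k * ‖a (j + k)‖ * R ^ k / (k.factorial : ℝ)
      ≤ poch (θ + j) k * (K * b ^ (j + k)) * R ^ k / (k.factorial : ℝ) := by
        gcongr; exact h _
    _ = _ := by rw [pow_add, mul_pow]; ring

theorem MinType.egfSummable_heat {θ : ℝ} (hθ : 0 ≤ θ) {a : ℕ → ℂ} (ha : MinType a) (j : ℕ) :
    EgfSummable fun k => (poch (θ + j) k : ℂ) * a (j + k) := by
  intro R hR
  obtain ⟨K, hK⟩ := ha (1 / (R + 1)) (by positivity)
  have hy : 1 / (R + 1) * R < 1 := by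
    rw [one_div_mul_eq_div, div_lt_one (by positivity)]
    linarith
  exact Summable.of_nonneg_of_le (fun k => by positivity) (fun k => hK.heat_term_le hθ hR j k)
    ((summable_poch_pow (by positivity) (by positivity) hy).mul_left _)

/-- The identity (x)_{k+1} = x (x + 1)_k turns the shifted series into the one with index `j + 1`:
this is the equation ∂_τ = Δ_θ read on coefficients. -/
theorem MinType.hasDerivAt_heatCoeff {θ : ℝ} (hθ : 0 ≤ θ) {a : ℕ → ℂ} (ha : MinType a) (j : ℕ)
    (τ : ℂ) :
    HasDerivAt (heatCoeff θ a j) (((θ + j : ℝ) : ℂ) * heatCoeff θ a (j + 1) τ) τ := by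
  have h := (ha.egfSummable_heat hθ j).hasDerivAt τ
  suffices e : ((θ + j : ℝ) : ℂ) * heatCoeff θ a (j + 1) τ =
      egf (fun k => (poch (θ + j) (k + 1) : ℂ) * a (j + (k + 1))) τ by
    rw [e]; exact h
  unfold heatCoeff egf
  rw [← tsum_mul_left]
  refine tsum_congr fun k => ?_
  have e : θ + ((j + 1 : ℕ) : ℝ) = θ + j + 1 := by push_cast; ring
  have e' : j + 1 + k = j + (k + 1) := by ring
  beta_reduce
  rw [poch_succ', e, e']
  push_cast
  ring

theorem MinType.exists_bound_heatCoeff {θ : ℝ} (hθ : 0 ≤ θ) {a : ℕ → ℂ} (ha : MinType a)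
    {T δ : ℝ} (hT : 0 ≤ T) (hδ : 0 < δ) :
    ∃ K, ∀ τ : ℂ, ‖τ‖ ≤ T → GeomBound K δ fun j => heatCoeff θ a j τ := by
  have hpos : 0 < 1 + δ * T := by positivity
  -- Summing the negative binomial series turns the growth rate b into b / (1 - bT); this b is the
  -- solution of b / (1 - bT) = δ.
  set b := δ / (1 + δ * T) with hb
  have hb0 : 0 < b := by positivity
  have hbT : 1 - b * T = 1 / (1 + δ * T) := by rw [hb]; field_simp; ring
  have hbT1 : b * T < 1 := by
    have : 0 < 1 / (1 + δ * T) := by positivity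
    linarith
  obtain ⟨K, hK⟩ := ha b hb0
  refine ⟨K * (1 + δ * T) ^ (⌈θ⌉₊ + 1), fun τ hτ j => ?_⟩
  have hK0 := hK.nonneg
  have hj : 0 ≤ θ + j := by positivity
  have hs := summable_poch_pow hj (by positivity) hbT1
  have h1 : ‖heatCoeff θ a j τ‖ ≤
      K * b ^ j * ∑' k : ℕ, poch (θ + j) k * (b * T) ^ k / (k.factorial : ℝ) := by
    refine tsum_of_norm_bounded (hs.hasSum.mul_left _) fun k => ?_
    rw [norm_egf_term fun k => (poch (θ + j) k : ℂ) * a (j + k)]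
    refine le_trans ?_ (hK.heat_term_le hθ hT j k)
    gcongr
  refine h1.trans ?_
  have h2 := tsum_poch_pow_le hj (add_nat_le_ceil_add_nat θ j) (by positivity : 0 ≤ b * T) hbT1
  rw [hbT, one_div_one_div] at h2
  calc K * b ^ j * ∑' k : ℕ, poch (θ + j) k * (b * T) ^ k / (k.factorial : ℝ)
      ≤ K * b ^ j * (1 + δ * T) ^ (⌈θ⌉₊ + j + 1) := by gcongr
    _ = K * (1 + δ * T) ^ (⌈θ⌉₊ + 1) * (b * (1 + δ * T)) ^ j := by rw [mul_pow]; ring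
    _ = _ := by rw [hb, div_mul_cancel₀ _ hpos.ne']

/-! ### The double series of exp(t Δ_θ) -/

theorem deltaOp_const_mul_pow (θ : ℝ) (c : ℂ) (n : ℕ) :
    deltaOp θ (fun w => c * w ^ (n + 1)) = fun w => (((n + 1) * (θ + n) : ℝ) : ℂ) * c * w ^ n := by
  have h1 : deriv (fun w : ℂ => c * w ^ (n + 1)) = fun w => c * ((n + 1 : ℕ) * w ^ n) := by
    funext w
    exact ((hasDerivAt_pow (n + 1) w).const_mul c).deriv
  have h2 : deriv (fun w : ℂ => c * (((n + 1 : ℕ) : ℂ) * w ^ n)) =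
      fun w => c * ((n + 1 : ℕ) * (n * w ^ (n - 1))) := by
    funext w
    exact (((hasDerivAt_pow n w).const_mul ((n + 1 : ℕ) : ℂ)).const_mul c).deriv
  funext w
  simp only [deltaOp, h1, h2]
  cases n with
  | zero => simp
  | succ n =>
    simp only [Nat.add_sub_cancel]
    push_cast
    ring

theorem deltaOp_const (θ : ℝ) (c : ℂ) : deltaOp θ (fun _ => c) = fun _ => 0 := by
  funext w
  simp [deltaOp]

theorem deltaOp_iterate_pow (θ : ℝ) (j k : ℕ) :
    (deltaOp θ)^[k] (fun w : ℂ => w ^ (j + k)) = fun w =>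
      (((j + k).factorial / (j.factorial : ℝ) * poch (θ + j) k : ℝ) : ℂ) * w ^ j := by
  induction k generalizing j with
  | zero =>
    have : (j.factorial : ℂ) ≠ 0 := Nat.cast_ne_zero.2 (Nat.factorial_ne_zero j)
    funext w
    simp [div_self this]
  | succ k ih =>
    have e : j + (k + 1) = (j + 1) + k := by ring
    rw [Function.iterate_succ_apply', e, ih (j + 1), deltaOp_const_mul_pow]
    funext w
    congr 1
    rw [← Complex.ofReal_mul]
    congr 1
    have hx : θ + ((j + 1 : ℕ) : ℝ) = θ + j + 1 := by push_cast; ring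
    rw [poch_succ', hx, Nat.factorial_succ j]
    have : (j.factorial : ℝ) ≠ 0 := Nat.cast_ne_zero.2 (Nat.factorial_ne_zero j)
    push_cast
    field_simp

/-- After `m` applications only a constant is left, and the next one kills it. -/
theorem deltaOp_iterate_pow_of_lt (θ : ℝ) {m k : ℕ} (h : m < k) :
    (deltaOp θ)^[k] (fun w : ℂ => w ^ m) = fun _ => 0 := by
  obtain ⟨r, rfl⟩ : ∃ r, k = (r + 1) + m := ⟨k - m - 1, by omega⟩
  have h0 := deltaOp_iterate_pow θ 0 m
  simp only [zero_add, pow_zero, mul_one] at h0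
  rw [Function.iterate_add_apply, h0]
  induction r with
  | zero => exact deltaOp_const θ _
  | succ r ih => rw [Function.iterate_succ_apply', ih (by omega), deltaOp_const]

/-- The terms of the double series of `exp (t Δ_θ) (egf a)`, collected by powers of `z`. -/
noncomputable def heatTerm (θ : ℝ) (a : ℕ → ℂ) (t z : ℂ) (p : ℕ × ℕ) : ℂ :=
  (poch (θ + p.1) p.2 : ℂ) * a (p.1 + p.2) * t ^ p.2 / (p.2.factorial : ℂ) *
    (z ^ p.1 / (p.1.factorial : ℂ))

theorem opSeriesTerm_exp (θ : ℝ) (g : ℂ → ℂ) (t z : ℂ) (j k : ℕ) :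
    opSeriesTerm θ (fun w : ℂ => Complex.exp (t * w)) g z (k, j + k) =
      heatTerm θ (fun n => iteratedDeriv n g 0) t z (j, k) := by
  have h1 : ((j + k).factorial : ℂ) ≠ 0 := Nat.cast_ne_zero.2 (Nat.factorial_ne_zero _)
  simp only [opSeriesTerm, heatTerm, deltaOp_iterate_pow, iteratedDeriv_cexp_const_mul]
  push_cast
  simp only [mul_zero, Complex.exp_zero]
  field_simp

theorem opSeriesTerm_exp_of_lt (θ : ℝ) (φ g : ℂ → ℂ) (z : ℂ) {k m : ℕ} (h : m < k) :
    opSeriesTerm θ φ g z (k, m) = 0 := by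
  simp [opSeriesTerm, deltaOp_iterate_pow_of_lt θ h]

theorem GeomBound.summable_norm_heatTerm {θ : ℝ} (hθ : 0 ≤ θ) {K b : ℝ} (hb : 0 ≤ b) {a : ℕ → ℂ}
    (h : GeomBound K b a) {t : ℂ} (htb : b * ‖t‖ < 1) (z : ℂ) :
    Summable fun p => ‖heatTerm θ a t z p‖ := by
  refine Summable.of_nonneg_of_le (fun _ => norm_nonneg _) (fun p => ?_)
    ((summable_pow_mul_poch hθ (X := b * ‖z‖) (by positivity) (by positivity) htb).mul_left K)
  have h1 := h.heat_term_le hθ (norm_nonneg t) p.1 p.2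
  rw [← norm_egf_term fun k => (poch (θ + p.1) k : ℂ) * a (p.1 + k)] at h1
  rw [heatTerm, norm_mul, norm_div (z ^ p.1), norm_pow, Complex.norm_natCast]
  calc _ ≤ K * b ^ p.1 * (poch (θ + p.1) p.2 * (b * ‖t‖) ^ p.2 / (p.2.factorial : ℝ)) *
        (‖z‖ ^ p.1 / (p.1.factorial : ℝ)) := by gcongr
    _ = _ := by rw [mul_pow b ‖z‖]; ring

/-- The reindexing (j, k) ↦ (k, j + k) from resulting power and number of applications misses
exactly the pairs with m < k, whose terms vanish. -/
theorem hasSum_opSeriesTerm_exp (θ : ℝ) (g : ℂ → ℂ) {t z S : ℂ}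
    (h : HasSum (heatTerm θ (fun n => iteratedDeriv n g 0) t z) S) :
    HasSum (opSeriesTerm θ (fun w : ℂ => Complex.exp (t * w)) g z) S := by
  have hinj : Function.Injective fun p : ℕ × ℕ => (p.2, p.1 + p.2) := by
    rintro ⟨j, k⟩ ⟨j', k'⟩ h
    simp only [Prod.mk.injEq] at h ⊢
    omega
  rw [← hinj.hasSum_iff]
  · convert h using 1
    funext p
    exact opSeriesTerm_exp θ g t z p.1 p.2
  · rintro ⟨k, m⟩ hp
    refine opSeriesTerm_exp_of_lt θ _ g z ?_
    by_contra hlt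
    exact hp ⟨(m - k, k), by
      simp only [not_lt] at hlt
      simp only [Prod.mk.injEq, true_and]
      omega⟩

theorem hasSum_heatTerm_egf {θ : ℝ} (hθ : 0 ≤ θ) {K b : ℝ} (hb : 0 ≤ b) {a : ℕ → ℂ}
    (h : GeomBound K b a) {t : ℂ} (htb : b * ‖t‖ < 1) (z : ℂ) :
    HasSum (heatTerm θ a t z) (egf (fun j => heatCoeff θ a j t) z) := by
  have hs := (h.summable_norm_heatTerm hθ hb htb z).of_norm
  have key : HasSum (fun j => heatCoeff θ a j t * (z ^ j / (j.factorial : ℂ)))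
      (∑' p, heatTerm θ a t z p) := by
    have hj : ∀ j : ℕ, Summable fun k : ℕ =>
        (poch (θ + j) k : ℂ) * a (j + k) * t ^ k / (k.factorial : ℂ) := by
      intro j
      refine Summable.of_norm (Summable.of_nonneg_of_le (fun _ => norm_nonneg _) (fun k => ?_)
        ((summable_poch_pow (x := θ + j) (by positivity) (by positivity) htb).mul_left
          (K * b ^ j)))
      rw [norm_egf_term fun k => (poch (θ + j) k : ℂ) * a (j + k)]
      exact h.heat_term_le hθ (norm_nonneg t) j k
    exact hs.hasSum.prod_fiberwise fun j => (hj j).hasSum.mul_right (z ^ j / (j.factorial : ℂ))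
  have e : egf (fun j => heatCoeff θ a j t) z = ∑' p, heatTerm θ a t z p := by
    rw [← key.tsum_eq]
    exact tsum_congr fun j => mul_div_assoc _ _ _
  rw [e]
  exact hs.hasSum

/-! ### Kummer's transformation -/

/-- The polynomial `∑ C(m, i) (θ + i)_{m - i} x ^ i`. -/
noncomputable def laguerreSum (θ : ℝ) (m : ℕ) (x : ℂ) : ℂ :=
  ∑ i ∈ range (m + 1), (((m.choose i : ℝ) * poch (θ + i) (m - i) : ℝ) : ℂ) * x ^ i

/-- Apply x^i (d/dx)^i to the exponential series. -/
theorem hasSum_pow_mul_descFactorial (x : ℂ) (i : ℕ) :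
    HasSum (fun j : ℕ => x ^ j / (j.factorial : ℂ) * (j.descFactorial i : ℂ))
      (x ^ i * Complex.exp x) := by
  have h := (hasSum_exp_complex x).mul_left (x ^ i)
  rw [← hasSum_nat_add_iff' i]
  rw [sum_eq_zero fun j hj => by rw [Nat.descFactorial_of_lt (mem_range.1 hj)]; simp, sub_zero]
  refine h.congr_fun fun j => ?_
  have h1 : (j + i).descFactorial i * j.factorial = (j + i).factorial := by
    rw [mul_comm, ← Nat.factorial_mul_descFactorial (Nat.le_add_left i j), Nat.add_sub_cancel]
  have h2 : ((j + i).factorial : ℂ) ≠ 0 := Nat.cast_ne_zero.2 (Nat.factorial_ne_zero _)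
  have h3 : (j.factorial : ℂ) ≠ 0 := Nat.cast_ne_zero.2 (Nat.factorial_ne_zero _)
  have h1' : ((j + i).descFactorial i : ℂ) * (j.factorial : ℂ) = ((j + i).factorial : ℂ) := by
    exact_mod_cast h1
  field_simp
  rw [← h1']
  ring

/-- Expand the rising product in falling factorials of `j` by Chu–Vandermonde; each of them
contributes x^i e^x. The common factor e^x is the one that the prefactor e^{-z/t} of the integral
formula removes. -/
theorem hasSum_poch_exp (θ : ℝ) (m : ℕ) (x : ℂ) :
    HasSum (fun j : ℕ => x ^ j / (j.factorial : ℂ) * (poch (θ + j) m : ℂ))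
      (Complex.exp x * laguerreSum θ m x) := by
  have h : HasSum (fun j : ℕ => ∑ i ∈ range (m + 1),
      (((m.choose i : ℝ) * poch (θ + i) (m - i) : ℝ) : ℂ) *
        (x ^ j / (j.factorial : ℂ) * (j.descFactorial i : ℂ)))
      (∑ i ∈ range (m + 1), (((m.choose i : ℝ) * poch (θ + i) (m - i) : ℝ) : ℂ) *
        (x ^ i * Complex.exp x)) :=
    hasSum_sum fun i _ => (hasSum_pow_mul_descFactorial x i).mul_left _
  convert h using 1
  · funext j
    rw [poch_add_nat_eq_sum, Complex.ofReal_sum, mul_sum]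
    refine sum_congr rfl fun i _ => ?_
    push_cast
    ring
  · rw [laguerreSum, mul_sum]
    exact sum_congr rfl fun i _ => by ring

/-- Group by antidiagonals j + k = m: there the coefficient `a m` and the power t^m are common,
since z^j t^k = t^m (z/t)^j. -/
theorem hasSum_laguerreSum_of_heatTerm {θ : ℝ} {a : ℕ → ℂ} {t z S : ℂ} (ht : t ≠ 0)
    (h : HasSum (heatTerm θ a t z) S) :
    HasSum (fun m : ℕ => a m * t ^ m / (m.factorial : ℂ) * laguerreSum θ m (z / t)) S := by
  have h2 := (Finset.HasAntidiagonal.sigmaAntidiagonalEquivProd (A := ℕ)).hasSum_iff.2 h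
  refine h2.sigma fun m => ?_
  have h3 := hasSum_fintype fun c : antidiagonal m =>
    (heatTerm θ a t z ∘ HasAntidiagonal.sigmaAntidiagonalEquivProd) ⟨m, c⟩
  suffices e : (∑ c : antidiagonal m,
      (heatTerm θ a t z ∘ HasAntidiagonal.sigmaAntidiagonalEquivProd) ⟨m, c⟩) =
      a m * t ^ m / (m.factorial : ℂ) * laguerreSum θ m (z / t) by
    rw [← e]; exact h3
  refine (sum_coe_sort (antidiagonal m) (heatTerm θ a t z)).trans ?_
  rw [Nat.sum_antidiagonal_eq_sum_range_succ_mk, laguerreSum, mul_sum]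
  refine sum_congr rfl fun i hi => ?_
  have him : i ≤ m := Nat.lt_succ_iff.1 (mem_range.1 hi)
  have h4 : (m.factorial : ℂ) ≠ 0 := Nat.cast_ne_zero.2 (Nat.factorial_ne_zero _)
  have h5 : t ^ m = t ^ i * t ^ (m - i) := by rw [← pow_add, Nat.add_sub_cancel' him]
  simp only [heatTerm, Nat.add_sub_cancel' him]
  push_cast
  rw [Nat.cast_choose ℂ him, div_pow, h5]
  field_simp

/-! ### The integral formula as a series -/

theorem one_le_poch {x : ℝ} (hx : 1 ≤ x) (k : ℕ) : 1 ≤ poch x k := by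
  induction k with
  | zero => simp
  | succ k ih =>
    rw [poch_succ]
    have : (0 : ℝ) ≤ k := by positivity
    nlinarith

theorem exists_geomBound_inv_Gamma {θ : ℝ} (hθ : 0 ≤ θ) :
    ∃ K, GeomBound K 1 fun k => (((Real.Gamma (θ + k))⁻¹ : ℝ) : ℂ) := by
  -- The index `k = 0` has its own summand because `θ = 0` is allowed; from `k = 1` on the recursion
  -- starts at `θ + 1 ≥ 1`, where rising products are at least 1.
  refine ⟨|(Real.Gamma θ)⁻¹| + |(Real.Gamma (θ + 1))⁻¹|, fun k => ?_⟩
  rw [Complex.norm_real, Real.norm_eq_abs, one_pow, mul_one]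
  cases k with
  | zero => simp
  | succ k =>
    have e : θ + ((k + 1 : ℕ) : ℝ) = (θ + 1) + k := by push_cast; ring
    have h1 := one_le_poch (x := θ + 1) (by linarith) k
    rw [e, Gamma_add_nat (by linarith), mul_inv, abs_mul]
    have h2 : |(poch (θ + 1) k)⁻¹| ≤ 1 := by
      rw [abs_inv, abs_of_pos (by linarith)]
      exact inv_le_one_of_one_le₀ h1
    have h3 := abs_nonneg (Real.Gamma θ)⁻¹
    have h4 := abs_nonneg (Real.Gamma (θ + 1))⁻¹
    nlinarith

theorem wTheta_term (θ : ℝ) (z : ℂ) (k : ℕ) : z ^ k / (gammaTheta θ k : ℂ) =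
    (((Real.Gamma (θ + k))⁻¹ : ℝ) : ℂ) * z ^ k / (k.factorial : ℂ) := by
  simp only [gammaTheta]
  push_cast
  rw [div_eq_mul_inv, mul_inv]
  ring

theorem wTheta_eq_egf (θ : ℝ) :
    wTheta θ = egf fun k => (((Real.Gamma (θ + k))⁻¹ : ℝ) : ℂ) :=
  funext fun z => tsum_congr fun k => wTheta_term θ z k

theorem summable_wTheta {θ : ℝ} (hθ : 0 ≤ θ) (z : ℂ) :
    Summable fun k : ℕ => ‖z ^ k / (gammaTheta θ k : ℂ)‖ := by
  obtain ⟨K, hK⟩ := exists_geomBound_inv_Gamma hθ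
  simpa only [wTheta_term] using (hK.egfSummable.summable z).norm

theorem continuous_wTheta {θ : ℝ} (hθ : 0 ≤ θ) : Continuous (wTheta θ) := by
  obtain ⟨K, hK⟩ := exists_geomBound_inv_Gamma hθ
  rw [wTheta_eq_egf]
  exact hK.egfSummable.differentiable.continuous

/-- The constant in the term `(j, m)` of the double expansion of the integrand. -/
noncomputable def integrandConst (θ : ℝ) (a : ℕ → ℂ) (t : ℝ) (z : ℂ) (p : ℕ × ℕ) : ℂ :=
  (z / t) ^ p.1 / (gammaTheta θ p.1 : ℂ) * (a p.2 * (t : ℂ) ^ p.2 / (p.2.factorial : ℂ))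

/-- The term `(j, m)` of the double expansion of the integrand. -/
noncomputable def integrandTerm (θ : ℝ) (a : ℕ → ℂ) (t : ℝ) (z : ℂ) (p : ℕ × ℕ) (s : ℝ) : ℂ :=
  integrandConst θ a t z p * ((Real.exp (-s) * s ^ (θ + p.1 + p.2 - 1) : ℝ) : ℂ)

theorem HasSum.mul_prod_of_norm {u v : ℕ → ℂ} {A B : ℂ} (hu : HasSum u A) (hv : HasSum v B) :
    HasSum (fun p : ℕ × ℕ => u p.1 * v p.2) (A * B) :=
  hu.mul hv (summable_mul_of_summable_norm hu.summable.norm hv.summable.norm)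

theorem hasSum_integrandTerm {θ : ℝ} (hθ : 0 ≤ θ) {g : ℂ → ℂ} (hg : Differentiable ℂ g) (t : ℝ)
    (z : ℂ) {s : ℝ} (hs : 0 < s) :
    HasSum (fun p => integrandTerm θ (fun n => iteratedDeriv n g 0) t z p s)
      (expDeltaIntegrand θ g t z s) := by
  have h1 := (summable_wTheta hθ (z * s / t)).of_norm.hasSum
  have h2 := hasSum_egf_of_differentiable hg ((t * s : ℝ) : ℂ)
  have h3 := (h1.mul_prod_of_norm h2).mul_left
    ((s ^ (θ - 1) * Real.exp (-s) : ℝ) : ℂ)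
  have e : expDeltaIntegrand θ g t z s = ((s ^ (θ - 1) * Real.exp (-s) : ℝ) : ℂ) *
      ((∑' k : ℕ, (z * s / t) ^ k / (gammaTheta θ k : ℂ)) * g ((t * s : ℝ) : ℂ)) := by
    rw [expDeltaIntegrand, wTheta]
    push_cast
    ring
  rw [e]
  refine h3.congr_fun fun p => ?_
  have e2 : θ + p.1 + p.2 - 1 = (θ - 1) + p.1 + p.2 := by ring
  rw [integrandTerm, integrandConst, e2, Real.rpow_add_natCast hs.ne', Real.rpow_add_natCast hs.ne']
  push_cast
  rw [mul_div_right_comm z, mul_pow (z / (t : ℂ)), mul_pow (t : ℂ)]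
  ring

theorem gammaTheta_zero_zero : gammaTheta 0 0 = 0 := by simp [gammaTheta]

theorem integrandConst_eq_zero (a : ℕ → ℂ) (t : ℝ) (z : ℂ) (m : ℕ) :
    integrandConst 0 a t z (0, m) = 0 := by
  simp [integrandConst, gammaTheta_zero_zero]

/-- The only degenerate case of the quotient Γ(θ + j + m) / Γ(θ + j) is θ = j = 0. There the
convention 1 / Γ(0) = 0 makes the whole term of the integrand vanish, so that s^{-1} never has to be
integrated. -/
theorem pos_or_eq_zero {θ : ℝ} (hθ : 0 ≤ θ) (j : ℕ) : 0 < θ + j ∨ (θ = 0 ∧ j = 0) := by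
  rcases Nat.eq_zero_or_pos j with rfl | hj
  · rcases hθ.eq_or_lt with h | h
    · exact Or.inr ⟨h.symm, rfl⟩
    · left; simpa using h
  · left
    have : (0 : ℝ) < j := by exact_mod_cast hj
    linarith

theorem integrableOn_integrandTerm {θ : ℝ} (hθ : 0 ≤ θ) (a : ℕ → ℂ) (t : ℝ) (z : ℂ) (p : ℕ × ℕ) :
    MeasureTheory.IntegrableOn (integrandTerm θ a t z p) (Set.Ioi 0) := by
  obtain ⟨j, m⟩ := p
  rcases pos_or_eq_zero hθ j with h | ⟨rfl, rfl⟩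
  · have h1 := (Real.GammaIntegral_convergent (s := θ + j + m) (by positivity)).ofReal (𝕜 := ℂ)
    exact h1.const_mul _
  · have : integrandTerm 0 a t z (0, m) = fun _ => 0 := by
      funext s
      rw [integrandTerm, integrandConst_eq_zero, zero_mul]
    rw [this]
    exact MeasureTheory.integrableOn_zero

theorem integral_integrandTerm {θ : ℝ} (hθ : 0 ≤ θ) (a : ℕ → ℂ) (t : ℝ) (z : ℂ) (p : ℕ × ℕ) :
    ∫ s in Set.Ioi (0 : ℝ), integrandTerm θ a t z p s =
      integrandConst θ a t z p * (Real.Gamma (θ + p.1 + p.2) : ℂ) := by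
  obtain ⟨j, m⟩ := p
  rcases pos_or_eq_zero hθ j with h | ⟨rfl, rfl⟩
  · simp only [integrandTerm]
    rw [MeasureTheory.integral_const_mul, integral_complex_ofReal,
      ← Real.Gamma_eq_integral (by positivity)]
  · simp only [integrandTerm, integrandConst_eq_zero, zero_mul, MeasureTheory.integral_zero]

theorem integral_norm_integrandTerm {θ : ℝ} (hθ : 0 ≤ θ) (a : ℕ → ℂ) (t : ℝ) (z : ℂ)
    (p : ℕ × ℕ) : ∫ s in Set.Ioi (0 : ℝ), ‖integrandTerm θ a t z p s‖ =
      ‖integrandConst θ a t z p‖ * Real.Gamma (θ + p.1 + p.2) := by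
  obtain ⟨j, m⟩ := p
  rcases pos_or_eq_zero hθ j with h | ⟨rfl, rfl⟩
  · rw [Real.Gamma_eq_integral (by positivity), ← MeasureTheory.integral_const_mul]
    refine MeasureTheory.setIntegral_congr_fun measurableSet_Ioi fun s hs => ?_
    have hs' : 0 < s := hs
    simp only [integrandTerm, norm_mul, Complex.norm_real]
    rw [Real.norm_of_nonneg (Real.exp_pos _).le, Real.norm_of_nonneg (Real.rpow_nonneg hs'.le _)]
  · simp only [integrandTerm, integrandConst_eq_zero, zero_mul, norm_zero,
      MeasureTheory.integral_zero]

/-- The terms `(z / t) ^ j / j! * (θ + j)_m * a_m t ^ m / m!`. -/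
noncomputable def kummerTerm (θ : ℝ) (a : ℕ → ℂ) (t : ℝ) (z : ℂ) (p : ℕ × ℕ) : ℂ :=
  (z / t) ^ p.1 / (p.1.factorial : ℂ) * (poch (θ + p.1) p.2 : ℂ) *
    (a p.2 * (t : ℂ) ^ p.2 / (p.2.factorial : ℂ))

theorem integrandConst_mul_Gamma {θ : ℝ} (a : ℕ → ℂ) (t : ℝ) (z : ℂ) (p : ℕ × ℕ)
    (hp : 0 < θ + p.1) :
    integrandConst θ a t z p * (Real.Gamma (θ + p.1 + p.2) : ℂ) = kummerTerm θ a t z p := by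
  have h1 : (Real.Gamma (θ + p.1) : ℂ) ≠ 0 := by exact_mod_cast (Real.Gamma_pos_of_pos hp).ne'
  rw [Gamma_add_nat hp, integrandConst, kummerTerm, gammaTheta]
  push_cast
  field_simp

/-- Equality can fail only for θ = 0 at the index (0, 0), where the left side is 0 and the right
side is `‖a 0‖`. -/
theorem norm_integrandConst_mul_Gamma_le {θ : ℝ} (hθ : 0 ≤ θ) (a : ℕ → ℂ) (t : ℝ) (z : ℂ)
    (p : ℕ × ℕ) :
    ‖integrandConst θ a t z p‖ * Real.Gamma (θ + p.1 + p.2) ≤ ‖kummerTerm θ a t z p‖ := by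
  rcases pos_or_eq_zero hθ p.1 with h | ⟨rfl, h⟩
  · rw [← integrandConst_mul_Gamma a t z p h, norm_mul, Complex.norm_real,
      Real.norm_of_nonneg (Real.Gamma_pos_of_pos (by positivity)).le]
  · obtain ⟨j, m⟩ := p
    simp only at h
    subst h
    rw [integrandConst_eq_zero]
    simp

theorem GeomBound.summable_norm_kummerTerm {θ : ℝ} (hθ : 0 ≤ θ) {K b : ℝ} (hb : 0 ≤ b) {a : ℕ → ℂ}
    (h : GeomBound K b a) {t : ℝ} (ht : 0 ≤ t) (htb : b * t < 1) (z : ℂ) :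
    Summable fun p => ‖kummerTerm θ a t z p‖ := by
  refine Summable.of_nonneg_of_le (fun _ => norm_nonneg _) (fun p => ?_)
    ((summable_pow_mul_poch hθ (X := ‖z / t‖) (by positivity) (by positivity) htb).mul_left K)
  have hp := poch_nonneg (x := θ + p.1) (by positivity) p.2
  rw [kummerTerm, norm_mul, norm_mul, norm_egf_term, norm_div, norm_pow, Complex.norm_natCast,
    Complex.norm_real, Complex.norm_real, Real.norm_of_nonneg hp, Real.norm_of_nonneg ht]
  calc _ ≤ ‖z / t‖ ^ p.1 / (p.1.factorial : ℝ) * poch (θ + p.1) p.2 *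
        (K * ((b * t) ^ p.2 / (p.2.factorial : ℝ))) := by
        gcongr
        exact h.term_le ht p.2
    _ = _ := by ring

theorem GeomBound.summable_integral_norm {θ : ℝ} (hθ : 0 ≤ θ) {K b : ℝ} (hb : 0 ≤ b)
    {a : ℕ → ℂ} (h : GeomBound K b a) {t : ℝ} (ht : 0 ≤ t) (htb : b * t < 1) (z : ℂ) :
    Summable fun p => ∫ s in Set.Ioi (0 : ℝ), ‖integrandTerm θ a t z p s‖ := by
  refine Summable.of_nonneg_of_le
    (fun p => MeasureTheory.integral_nonneg fun _ => norm_nonneg _) (fun p => ?_)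
    (h.summable_norm_kummerTerm hθ hb ht htb z)
  rw [integral_norm_integrandTerm hθ]
  exact norm_integrandConst_mul_Gamma_le hθ a t z p

theorem measurable_expDeltaIntegrand {θ : ℝ} (hθ : 0 ≤ θ) {g : ℂ → ℂ} (hg : Differentiable ℂ g)
    (t : ℝ) (z : ℂ) : Measurable (expDeltaIntegrand θ g t z) := by
  have h1 := (continuous_wTheta hθ).measurable
  have h2 := hg.continuous.measurable
  unfold expDeltaIntegrand
  fun_prop

theorem integrable_expDeltaIntegrand_of_geomBound {θ : ℝ} (hθ : 0 ≤ θ) {g : ℂ → ℂ}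
    (hg : Differentiable ℂ g) {K b : ℝ} (hb : 0 ≤ b)
    (h : GeomBound K b fun n => iteratedDeriv n g 0) {t : ℝ} (ht : 0 ≤ t) (htb : b * t < 1)
    (z : ℂ) : MeasureTheory.IntegrableOn (expDeltaIntegrand θ g t z) (Set.Ioi 0) := by
  refine ⟨(measurable_expDeltaIntegrand hθ hg t z).aestronglyMeasurable, ?_⟩
  rw [MeasureTheory.hasFiniteIntegral_iff_enorm]
  set J := integrandTerm θ (fun n => iteratedDeriv n g 0) t z with hJ
  have hint : ∀ p, MeasureTheory.IntegrableOn (J p) (Set.Ioi 0) :=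
    integrableOn_integrandTerm hθ _ t z
  have hsum : Summable fun p => ∫ s in Set.Ioi (0 : ℝ), ‖J p s‖ :=
    h.summable_integral_norm hθ hb ht htb z
  calc ∫⁻ s in Set.Ioi (0 : ℝ), ‖expDeltaIntegrand θ g t z s‖ₑ
      ≤ ∫⁻ s in Set.Ioi (0 : ℝ), ∑' p, ‖J p s‖ₑ := by
        refine MeasureTheory.setLIntegral_mono' measurableSet_Ioi fun s hs => ?_
        have hs' := hasSum_integrandTerm hθ hg t z hs
        rw [← hs'.tsum_eq]
        exact enorm_tsum_le_tsum_enorm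
    _ = ∑' p, ∫⁻ s in Set.Ioi (0 : ℝ), ‖J p s‖ₑ :=
        MeasureTheory.lintegral_tsum fun p => (hint p).1.enorm
    _ = ∑' p, ENNReal.ofReal (∫ s in Set.Ioi (0 : ℝ), ‖J p s‖) := by
        refine tsum_congr fun p => ?_
        rw [MeasureTheory.ofReal_integral_norm_eq_lintegral_enorm (hint p)]
    _ < ⊤ := hsum.tsum_ofReal_lt_top

/-- Integrate termwise. For θ = 0 the integral loses exactly the term (0, 0), which is `g 0`; the
extra summand in the definition of the operator restores it. The other terms with j = 0 vanish on
both sides because (0)_m = 0 for m ≥ 1. -/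
theorem hasSum_kummerTerm {θ : ℝ} (hθ : 0 ≤ θ) {g : ℂ → ℂ}
    (hg : Differentiable ℂ g) {K b : ℝ} (hb : 0 ≤ b)
    (h : GeomBound K b fun n => iteratedDeriv n g 0) {t : ℝ} (ht : 0 ≤ t) (htb : b * t < 1)
    (z : ℂ) : HasSum (kummerTerm θ (fun n => iteratedDeriv n g 0) t z)
      ((∫ s in Set.Ioi (0 : ℝ), expDeltaIntegrand θ g t z s) + (if θ = 0 then g 0 else 0)) := by
  set a := fun n => iteratedDeriv n g 0 with ha
  have h1 := MeasureTheory.hasSum_integral_of_summable_integral_norm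
    (integrableOn_integrandTerm hθ a t z) (h.summable_integral_norm hθ hb ht htb z)
  have h2 : ∫ s in Set.Ioi (0 : ℝ), ∑' p, integrandTerm θ a t z p s =
      ∫ s in Set.Ioi (0 : ℝ), expDeltaIntegrand θ g t z s :=
    MeasureTheory.setIntegral_congr_fun measurableSet_Ioi fun s hs =>
      (hasSum_integrandTerm hθ hg t z hs).tsum_eq
  rw [h2] at h1
  have h3 : HasSum (fun p : ℕ × ℕ => if p = (0, 0) then (if θ = 0 then g 0 else 0) else 0)
      (if θ = 0 then g 0 else 0) := hasSum_ite_eq (0, 0) _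
  refine (h1.add h3).congr_fun fun p => ?_
  rw [integral_integrandTerm hθ]
  rcases pos_or_eq_zero hθ p.1 with hp | ⟨rfl, hp⟩
  · rw [integrandConst_mul_Gamma a t z p hp]
    have : ¬ (p = (0, 0) ∧ θ = 0) := by
      rintro ⟨rfl, rfl⟩
      simp at hp
    rw [← ite_and, if_neg this, add_zero]
  · obtain ⟨j, m⟩ := p
    simp only at hp
    subst hp
    rw [integrandConst_eq_zero, zero_mul, zero_add]
    rcases Nat.eq_zero_or_pos m with rfl | hm
    · simp [kummerTerm, ha]
    · have : poch 0 m = 0 := poch_zero_left hm.ne'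
      simp [kummerTerm, this, hm.ne']

/-- Here the sum over `j` is carried out first, for fixed `m`, by Kummer's transformation. -/
theorem hasSum_laguerreSum_of_kummerTerm {θ : ℝ} {a : ℕ → ℂ} {t : ℝ} {z V : ℂ}
    (h : HasSum (kummerTerm θ a t z) V) :
    HasSum (fun m : ℕ => a m * (t : ℂ) ^ m / (m.factorial : ℂ) *
      (Complex.exp (z / t) * laguerreSum θ m (z / t))) V := by
  have h2 := (Equiv.prodComm ℕ ℕ).hasSum_iff.2 h
  refine h2.prod_fiberwise fun m => ?_
  refine ((hasSum_poch_exp θ m (z / t)).mul_left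
    (a m * (t : ℂ) ^ m / (m.factorial : ℂ))).congr_fun fun j => ?_
  simp only [Function.comp_apply, Equiv.prodComm_apply, Prod.swap_prod_mk, kummerTerm]
  ring

/-- In the range of convergence of the double series, the integral operator is its sum. -/
theorem hasSum_heatTerm_expDelta {θ : ℝ} (hθ : 0 ≤ θ) {g : ℂ → ℂ}
    (hg : Differentiable ℂ g) {K b : ℝ} (hb : 0 ≤ b)
    (h : GeomBound K b fun n => iteratedDeriv n g 0) {t : ℝ} (ht : 0 ≤ t) (htb : b * t < 1)
    (z : ℂ) : HasSum (heatTerm θ (fun n => iteratedDeriv n g 0) t z) (expDelta θ t g z) := by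
  have htb' : b * ‖(t : ℂ)‖ < 1 := by rwa [Complex.norm_real, Real.norm_of_nonneg ht]
  have hs := (h.summable_norm_heatTerm hθ hb htb' z).of_norm.hasSum
  rcases ht.eq_or_lt with rfl | ht0
  · have h1 := hasSum_heatTerm_egf hθ hb h htb' z
    convert h1 using 1
    rw [expDelta, if_pos rfl]
    conv_lhs => rw [eq_egf_of_differentiable hg]
    congr 1
    funext j
    rw [heatCoeff, Complex.ofReal_zero, egf_zero]
    simp
  -- The double series and the integral both become single series in `m` with the same polynomials,
  -- the second with an additional factor e^{z/t}; uniqueness of sums identifies them.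
  · have htc : (t : ℂ) ≠ 0 := by exact_mod_cast ht0.ne'
    have h1 := (hasSum_laguerreSum_of_heatTerm htc hs).mul_left (Complex.exp (z / t))
    have h2 := hasSum_laguerreSum_of_kummerTerm (hasSum_kummerTerm hθ hg hb h ht htb z)
    have h3 := h2.unique (h1.congr_fun fun m => by ring)
    rw [expDelta, if_neg ht0.ne', h3, ← mul_assoc, ← Complex.exp_add, neg_div, neg_add_cancel,
      Complex.exp_zero, one_mul]
    exact hs

theorem expDelta_eq_egf {θ : ℝ} (hθ : 0 ≤ θ) {g : ℂ → ℂ}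
    (hg : Differentiable ℂ g) {K b : ℝ} (hb : 0 ≤ b)
    (h : GeomBound K b fun n => iteratedDeriv n g 0) {t : ℝ} (ht : 0 ≤ t) (htb : b * t < 1)
    (z : ℂ) : expDelta θ t g z =
      egf (fun j => heatCoeff θ (fun n => iteratedDeriv n g 0) j t) z :=
  (hasSum_heatTerm_expDelta hθ hg hb h ht htb z).unique (hasSum_heatTerm_egf hθ hb h
    (by rwa [Complex.norm_real, Real.norm_of_nonneg ht]) z)

/-! ### Δ_θ as a weighted shift -/

theorem egf_const_mul (l : ℂ) (c : ℕ → ℂ) (z : ℂ) : egf (fun k => l * c k) z = l * egf c z := by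
  unfold egf
  rw [← tsum_mul_left]
  exact tsum_congr fun k => by ring

theorem egf_mul_pow (q : ℂ) (c : ℕ → ℂ) (z : ℂ) : egf (fun k => q ^ k * c k) z = egf c (q * z) :=
  tsum_congr fun k => by rw [mul_pow]; ring

theorem EgfSummable.egf_add {c d : ℕ → ℂ} (hc : EgfSummable c) (hd : EgfSummable d) (z : ℂ) :
    egf (fun k => c k + d k) z = egf c z + egf d z := by
  unfold egf
  rw [← (hc.summable z).tsum_add (hd.summable z)]
  exact tsum_congr fun k => by ring

theorem EgfSummable.egf_sub {c d : ℕ → ℂ} (hc : EgfSummable c) (hd : EgfSummable d) (z : ℂ) :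
    egf (fun k => c k - d k) z = egf c z - egf d z := by
  unfold egf
  rw [← (hc.summable z).tsum_sub (hd.summable z)]
  exact tsum_congr fun k => by ring

theorem EgfSummable.mul_egf_shift {c : ℕ → ℂ} (hc : EgfSummable c) (z : ℂ) :
    z * egf (fun k => c (k + 1)) z = egf (fun k => (k : ℂ) * c k) z := by
  have h1 := (hc.shift.hasSum z).mul_left z
  have h2 : HasSum (fun k : ℕ => ((k + 1 : ℕ) : ℂ) * c (k + 1) * z ^ (k + 1) /
      ((k + 1).factorial : ℂ)) (z * egf (fun k => c (k + 1)) z) := by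
    refine h1.congr_fun fun k => ?_
    have : ((k : ℂ) + 1) ≠ 0 := by exact_mod_cast Nat.succ_ne_zero k
    rw [Nat.factorial_succ, pow_succ]
    push_cast
    field_simp
  have h3 := (hasSum_nat_add_iff (f := fun k : ℕ => (k : ℂ) * c k * z ^ k /
    (k.factorial : ℂ)) 1).1 h2
  simp only [range_one, sum_singleton, Nat.cast_zero, zero_mul, zero_div, add_zero] at h3
  exact h3.tsum_eq.symm

theorem EgfSummable.const_mul {c : ℕ → ℂ} (hc : EgfSummable c) (l : ℂ) :
    EgfSummable fun k => l * c k := by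
  intro R hR
  refine ((hc R hR).mul_left ‖l‖).congr fun k => ?_
  rw [norm_mul]
  ring

theorem EgfSummable.natCast_mul {c : ℕ → ℂ} (hc : EgfSummable c) :
    EgfSummable fun k => (k : ℂ) * c k := by
  intro R hR
  refine Summable.of_nonneg_of_le (fun k => by positivity) (fun k => ?_)
    (hc (2 * R) (by positivity))
  have h1 : (k : ℝ) ≤ 2 ^ k := by exact_mod_cast (Nat.lt_two_pow_self).le
  rw [norm_mul, Complex.norm_natCast, mul_pow]
  calc (k : ℝ) * ‖c k‖ * R ^ k / (k.factorial : ℝ)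
      ≤ 2 ^ k * ‖c k‖ * R ^ k / (k.factorial : ℝ) := by gcongr
    _ = _ := by ring

/-- D shifts the coefficients and zD multiplies the k-th one by k. -/
theorem EgfSummable.deltaOp_egf {c : ℕ → ℂ} (hc : EgfSummable c) (θ : ℝ) :
    deltaOp θ (egf c) = egf fun k => ((θ + k : ℝ) : ℂ) * c (k + 1) := by
  funext z
  rw [deltaOp, hc.deriv, hc.shift.deriv, hc.shift.mul_egf_shift, ← egf_const_mul,
    ← (hc.shift.const_mul _).egf_add hc.shift.natCast_mul]
  congr 1
  funext k
  push_cast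
  ring

theorem minType_of_mem_spaceA {h : ℂ → ℂ} (hh : h ∈ spaceA 0) :
    MinType fun n => iteratedDeriv n h 0 :=
  fun _ hb => exists_geomBound_of_mem_spaceA le_rfl hb hh

theorem exists_geomBound_exp_mul {ε b : ℝ} (hε : 0 ≤ ε) (hb : ε < b) {g h : ℂ → ℂ}
    (hh : h ∈ spaceA 0) (hg : ∀ z : ℂ, g z = Complex.exp (-(ε : ℂ) * z) * h z) :
    ∃ K, GeomBound K b fun n => iteratedDeriv n g 0 := by
  have hd := differentiable_of_mem_spaceA hh
  obtain ⟨K, hK⟩ := minType_of_mem_spaceA hh (b - ε) (by linarith)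
  have e : g = egf (expConv (-(ε : ℂ)) fun n => iteratedDeriv n h 0) := by
    funext z
    rw [hg, ← exp_mul_egf _ hK.egfSummable, ← eq_egf_of_differentiable hd]
  have h2 := hK.expConv (-(ε : ℂ))
  refine ⟨K, ?_⟩
  rw [norm_neg, Complex.norm_real, Real.norm_of_nonneg hε, add_sub_cancel] at h2
  rw [e]
  simpa only [h2.egfSummable.iteratedDeriv_zero] using h2

theorem differentiable_exp_mul {ε : ℝ} {g h : ℂ → ℂ} (hh : Differentiable ℂ h)
    (hg : ∀ z : ℂ, g z = Complex.exp (-(ε : ℂ) * z) * h z) : Differentiable ℂ g := by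
  rw [funext hg]
  fun_prop

/-! ### Functions with an exponential factor -/

/-- The contraction factor `1 / (1 + ε t)`. -/
noncomputable def contr (ε t : ℝ) : ℝ := (1 + ε * t)⁻¹

theorem contr_pos {ε t : ℝ} (h : 0 < 1 + ε * t) : 0 < contr ε t := inv_pos.2 h

theorem contr_mul {ε t : ℝ} (h : 0 < 1 + ε * t) : contr ε t * (1 + ε * t) = 1 :=
  inv_mul_cancel₀ h.ne'

theorem contr_le_one {ε t : ℝ} (hε : 0 ≤ ε) (ht : 0 ≤ t) : contr ε t ≤ 1 :=
  inv_le_one_of_one_le₀ (by nlinarith [mul_nonneg hε ht])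

/-- The two exponentials combine to e^{-(1 + εt)s}, which suggests the variable (1 + εt)s. Replacing
t by tA keeps the argument ts of `h` fixed, and replacing z by A² z keeps zs/t fixed; only the power
of s leaves a constant. -/
theorem expDeltaIntegrand_exp_mul {θ ε t : ℝ} (hε : 0 ≤ ε) (ht : 0 < t) {g h : ℂ → ℂ}
    (hg : ∀ z : ℂ, g z = Complex.exp (-(ε : ℂ) * z) * h z) (z : ℂ) {s : ℝ} (hs : 0 < s) :
    expDeltaIntegrand θ g t z s = (((1 + ε * t) ^ (1 - θ) : ℝ) : ℂ) *
      expDeltaIntegrand θ h (t * contr ε t) ((contr ε t : ℂ) ^ 2 * z) ((1 + ε * t) * s) := by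
  have hc : 0 < 1 + ε * t := by positivity
  have hA := contr_pos hc
  have hAc := contr_mul hc
  set c := 1 + ε * t with hcdef
  set A := contr ε t
  have htC : (t : ℂ) ≠ 0 := by exact_mod_cast ht.ne'
  have hAC : (A : ℂ) ≠ 0 := by exact_mod_cast hA.ne'
  have hAcC : (A : ℂ) * (c : ℂ) = 1 := by exact_mod_cast hAc
  have e1 : (A : ℂ) ^ 2 * z * ((c * s : ℝ) : ℂ) / ((t * A : ℝ) : ℂ) = z * s / t := by
    push_cast
    field_simp
    linear_combination s * z * hAcC
  have e2 : t * A * (c * s) = t * s := by linear_combination t * s * hAc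
  have e3 : c ^ (1 - θ) * (c * s) ^ (θ - 1) = s ^ (θ - 1) := by
    rw [Real.mul_rpow hc.le hs.le, ← mul_assoc, ← Real.rpow_add hc]
    simp
  have e4 : Real.exp (-(c * s)) = Real.exp (-s) * Real.exp (-(ε * (t * s))) := by
    rw [← Real.exp_add]
    congr 1
    rw [hcdef]
    ring
  simp only [expDeltaIntegrand]
  rw [e1, e2, e4, hg, ← e3]
  push_cast
  rw [neg_mul]
  ring

theorem integrableOn_expDeltaIntegrand {θ ε : ℝ} (hθ : 0 ≤ θ) (hε : 0 ≤ ε) {g h : ℂ → ℂ}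
    (hh : h ∈ spaceA 0) (hg : ∀ z : ℂ, g z = Complex.exp (-(ε : ℂ) * z) * h z) {t : ℝ}
    (ht : 0 < t) (z : ℂ) :
    MeasureTheory.IntegrableOn (expDeltaIntegrand θ g t z) (Set.Ioi (0 : ℝ)) := by
  have hc : 0 < 1 + ε * t := by positivity
  have hT : 0 < t * contr ε t := mul_pos ht (contr_pos hc)
  set T := t * contr ε t
  -- Any rate below 1 / T would do. Type zero provides one for every T, so no restriction on `t` is
  -- needed.
  obtain ⟨K, hK⟩ := minType_of_mem_spaceA hh (1 / (T + 1)) (by positivity)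
  have hlt : 1 / (T + 1) * T < 1 := by
    rw [one_div_mul_eq_div, div_lt_one (by positivity)]
    linarith
  have h1 := integrable_expDeltaIntegrand_of_geomBound hθ (differentiable_of_mem_spaceA hh)
    (by positivity) hK hT.le hlt ((contr ε t : ℂ) ^ 2 * z)
  have h2 := (MeasureTheory.integrableOn_Ioi_comp_mul_left_iff _ 0 hc).2 (by rwa [mul_zero])
  refine MeasureTheory.IntegrableOn.congr_fun
    (MeasureTheory.Integrable.const_mul h2 (((1 + ε * t) ^ (1 - θ) : ℝ) : ℂ))
    (fun s hs => ?_) measurableSet_Ioi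
  exact (expDeltaIntegrand_exp_mul hε ht hg z hs).symm

/-- The action of `exp (t Δ_θ)` on a function with an exponential factor. -/
theorem expDelta_exp_mul {θ ε t : ℝ} (hε : 0 ≤ ε) (ht : 0 ≤ t) {g h : ℂ → ℂ}
    (hg : ∀ z : ℂ, g z = Complex.exp (-(ε : ℂ) * z) * h z) (z : ℂ) :
    expDelta θ t g z = (((contr ε t) ^ θ : ℝ) : ℂ) *
      (Complex.exp (-((ε * contr ε t : ℝ) : ℂ) * z) *
        expDelta θ (t * contr ε t) h ((contr ε t : ℂ) ^ 2 * z)) := by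
  rcases ht.eq_or_lt with rfl | ht0
  · simp [expDelta, contr, hg]
  have hc : 0 < 1 + ε * t := by positivity
  have hA := contr_pos hc
  have hAc := contr_mul hc
  have htA : t * contr ε t ≠ 0 := (mul_pos ht0 hA).ne'
  have hint : ∫ s in Set.Ioi (0 : ℝ), expDeltaIntegrand θ g t z s =
      (((contr ε t) ^ θ : ℝ) : ℂ) * ∫ s in Set.Ioi (0 : ℝ),
        expDeltaIntegrand θ h (t * contr ε t) ((contr ε t : ℂ) ^ 2 * z) s := by
    rw [MeasureTheory.setIntegral_congr_fun measurableSet_Ioi fun s hs =>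
      expDeltaIntegrand_exp_mul hε ht0 hg z hs, MeasureTheory.integral_const_mul,
      MeasureTheory.integral_comp_mul_left_Ioi (fun s => expDeltaIntegrand θ h (t * contr ε t)
        ((contr ε t : ℂ) ^ 2 * z) s) 0 hc, mul_zero, Complex.real_smul, ← mul_assoc,
      ← Complex.ofReal_mul]
    congr 2
    -- The exponent 1 - θ comes from the integrand and -1 from the change of variables.
    rw [contr, Real.inv_rpow hc.le, ← Real.rpow_neg hc.le, ← Real.rpow_neg_one, ← Real.rpow_add hc]
    congr 1
    ring
  have hdelta : (if θ = 0 then g 0 else 0) =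
      (((contr ε t) ^ θ : ℝ) : ℂ) * (if θ = 0 then h 0 else 0) := by
    split_ifs with hθ
    · simp [hθ, hg]
    · simp
  -- The exponents agree because 1 / t = εA + A / t.
  have hexp : Complex.exp (-z / t) = Complex.exp (-((ε * contr ε t : ℝ) : ℂ) * z) *
      Complex.exp (-((contr ε t : ℂ) ^ 2 * z) / ((t * contr ε t : ℝ) : ℂ)) := by
    rw [← Complex.exp_add]
    congr 1
    have htC : (t : ℂ) ≠ 0 := by exact_mod_cast ht0.ne'
    have hAC : (contr ε t : ℂ) ≠ 0 := by exact_mod_cast hA.ne'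
    have hAcC : (contr ε t : ℂ) * (1 + ε * t) = 1 := by exact_mod_cast hAc
    push_cast
    field_simp
    linear_combination z * hAcC
  rw [expDelta, expDelta, if_neg ht0.ne', if_neg htA, hint, hdelta, hexp]
  ring

/-- The coefficients of `exp (τ Δ_θ) h` for `h` of order zero growth. -/
theorem expDelta_eq_egf_of_mem_spaceA_zero {θ : ℝ} (hθ : 0 ≤ θ) {h : ℂ → ℂ} (hh : h ∈ spaceA 0)
    {τ : ℝ} (hτ : 0 ≤ τ) (z : ℂ) :
    expDelta θ τ h z = egf (fun j => heatCoeff θ (fun n => iteratedDeriv n h 0) j τ) z := by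
  obtain ⟨K, hK⟩ := minType_of_mem_spaceA hh (1 / (τ + 1)) (by positivity)
  have hlt : 1 / (τ + 1) * τ < 1 := by
    rw [one_div_mul_eq_div, div_lt_one (by positivity)]
    linarith
  exact expDelta_eq_egf hθ (differentiable_of_mem_spaceA hh) (by positivity) hK hτ hlt z

/-! ### Coefficients of the extended flow -/

/-- The derivatives at `0` of `exp (t Δ_θ) (exp (-ε z) * egf a)`. -/
noncomputable def flowCoeff (θ ε : ℝ) (a : ℕ → ℂ) (k : ℕ) (t : ℝ) : ℂ :=
  ∑ j ∈ range (k + 1), (k.choose j : ℂ) * (-(ε : ℂ)) ^ (k - j) *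
    ((((contr ε t) ^ (θ + k + j) : ℝ) : ℂ) * heatCoeff θ a j ((t * contr ε t : ℝ) : ℂ))

theorem norm_mul_contr_le {ε t T : ℝ} (hε : 0 ≤ ε) (ht : 0 ≤ t) (htT : t ≤ T) :
    ‖((t * contr ε t : ℝ) : ℂ)‖ ≤ T := by
  have hA := contr_pos (ε := ε) (t := t) (by positivity)
  have hA1 := contr_le_one hε ht
  rw [Complex.norm_real, Real.norm_of_nonneg (by positivity)]
  nlinarith

/-- Binomial convolution with powers of ε adds growth rates, so the rate b - ε > 0 for the heat
coefficients suffices. The powers of A are at most 1 and tA ≤ T, hence one constant serves all of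
[0, T]. -/
theorem MinType.exists_bound_flowCoeff {θ ε : ℝ} (hθ : 0 ≤ θ) (hε : 0 ≤ ε) {a : ℕ → ℂ}
    (ha : MinType a) {T b : ℝ} (hT : 0 ≤ T) (hb : ε < b) :
    ∃ K, ∀ t : ℝ, 0 ≤ t → t ≤ T → GeomBound K b fun k => flowCoeff θ ε a k t := by
  obtain ⟨K, hK⟩ := ha.exists_bound_heatCoeff hθ hT (sub_pos.2 hb)
  refine ⟨K, fun t ht htT k => ?_⟩
  have hA := contr_pos (ε := ε) (t := t) (by positivity)
  have hA1 := contr_le_one hε ht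
  refine (norm_sum_le _ _).trans ?_
  have e : b ^ k = ((b - ε) + ε) ^ k := by ring
  rw [e, add_pow, mul_sum]
  refine sum_le_sum fun j _ => ?_
  rw [norm_mul, norm_mul, norm_mul, norm_pow, norm_neg, Complex.norm_real, Complex.norm_real,
    Complex.norm_natCast, Real.norm_of_nonneg hε, Real.norm_of_nonneg (by positivity)]
  have h1 := hK _ (norm_mul_contr_le hε ht htT) j
  have h2 : contr ε t ^ (θ + k + j) ≤ 1 := Real.rpow_le_one hA.le hA1 (by positivity)
  calc _ ≤ (k.choose j : ℝ) * ε ^ (k - j) * (1 * (K * (b - ε) ^ j)) := by gcongr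
    _ = _ := by ring

theorem expDelta_eq_egf_flowCoeff {θ ε : ℝ} (hθ : 0 ≤ θ) (hε : 0 ≤ ε) {g h : ℂ → ℂ}
    (hh : h ∈ spaceA 0) (hg : ∀ z : ℂ, g z = Complex.exp (-(ε : ℂ) * z) * h z) {t : ℝ}
    (ht : 0 ≤ t) :
    expDelta θ t g = egf fun k => flowCoeff θ ε (fun n => iteratedDeriv n h 0) k t := by
  have hA := contr_pos (ε := ε) (t := t) (by positivity)
  have hm := minType_of_mem_spaceA hh
  have hτ : 0 ≤ t * contr ε t := by positivity
  funext z
  rw [expDelta_exp_mul hε ht hg, expDelta_eq_egf_of_mem_spaceA_zero hθ hh hτ, ← egf_mul_pow]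
  set A := contr ε t
  set C := fun j => heatCoeff θ (fun n => iteratedDeriv n h 0) j ((t * A : ℝ) : ℂ) with hC
  have hs : EgfSummable fun k => ((A : ℂ) ^ 2) ^ k * C k := by
    obtain ⟨K, hK⟩ := hm.exists_bound_heatCoeff hθ ht one_pos
    have hK' := hK _ (norm_mul_contr_le hε ht le_rfl)
    intro R hR
    refine (hK'.egfSummable (A ^ 2 * R) (by positivity)).congr fun k => ?_
    rw [norm_mul, norm_pow, norm_pow, Complex.norm_real, Real.norm_of_nonneg hA.le, mul_pow]
    ring
  rw [exp_mul_egf _ hs, ← egf_const_mul]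
  congr 1
  funext k
  rw [expConv, flowCoeff, mul_sum]
  refine sum_congr rfl fun j hj => ?_
  have hjk : j ≤ k := Nat.lt_succ_iff.1 (mem_range.1 hj)
  -- A^θ is the prefactor, A^{k-j} comes from e^{-εAz}, and A^{2j} from the argument A² z.
  have e1 : A ^ (θ + k + j) = A ^ θ * (A ^ (k - j) * (A ^ 2) ^ j) := by
    rw [Real.rpow_add_natCast hA.ne', Real.rpow_add_natCast hA.ne', mul_assoc, ← pow_add, ← pow_mul,
      ← pow_add]
    congr 2
    omega
  have e2 : (-((ε * A : ℝ) : ℂ)) ^ (k - j) = (-(ε : ℂ)) ^ (k - j) * (A : ℂ) ^ (k - j) := by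
    rw [← mul_pow]
    congr 1
    push_cast
    ring
  rw [e1, e2]
  simp only [hC]
  push_cast
  ring

/-- This is the algebra behind the derivative of `flowCoeff`: the two terms on the left come from
differentiating a power of A and a heat coefficient. It combines Pascal's rule with (j + 1) C(k,
j+1) = (k - j) C(k, j). -/
theorem sum_choose_step (θ : ℝ) (k : ℕ) (X : ℕ → ℂ) :
    ∑ j ∈ range (k + 1), (k.choose j : ℂ) * ((θ + k + j) * X j + (θ + j) * X (j + 1)) =
      (θ + k) * ∑ j ∈ range (k + 2), ((k + 1).choose j : ℂ) * X j := by
  have h1 : ∑ j ∈ range (k + 2), ((k + 1).choose j : ℂ) * X j =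
      ∑ j ∈ range (k + 1), (k.choose j : ℂ) * X j +
        ∑ j ∈ range (k + 1), (k.choose j : ℂ) * X (j + 1) := by
    rw [sum_range_succ' _ (k + 1)]
    have : ∀ j, ((k + 1).choose (j + 1) : ℂ) * X (j + 1) =
        (k.choose j : ℂ) * X (j + 1) + (k.choose (j + 1) : ℂ) * X (j + 1) := by
      intro j
      rw [Nat.choose_succ_succ]
      push_cast
      ring
    simp only [this, sum_add_distrib]
    rw [sum_range_succ' (fun j => (k.choose j : ℂ) * X j), sum_range_succ
      (fun j => (k.choose (j + 1) : ℂ) * X (j + 1)) k]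
    simp
    ring
  have h2 : ∑ j ∈ range (k + 1), (k.choose j : ℂ) * ((j : ℂ) * X j) =
      ∑ j ∈ range (k + 1), (k.choose j : ℂ) * (((k : ℂ) - j) * X (j + 1)) := by
    rw [sum_range_succ', sum_range_succ _ k]
    simp only [Nat.cast_zero, zero_mul, mul_zero, add_zero, sub_self]
    refine sum_congr rfl fun j hj => ?_
    have hjk : j ≤ k := (mem_range.1 hj).le
    have := Nat.choose_succ_right_eq k j
    have h' : (k.choose (j + 1) : ℂ) * ((j : ℂ) + 1) = (k.choose j : ℂ) * ((k : ℂ) - j) := by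
      rw [← Nat.cast_sub hjk]
      exact_mod_cast this
    push_cast
    linear_combination X (j + 1) * h'
  rw [h1, mul_add, mul_sum, mul_sum, ← sub_eq_zero]
  have h3 := sub_eq_zero.2 h2
  rw [← sum_sub_distrib] at h3
  rw [← sum_add_distrib, ← sum_sub_distrib, ← h3]
  exact sum_congr rfl fun j _ => by ring

theorem hasDerivAt_contr {ε t : ℝ} (h : 0 < 1 + ε * t) :
    HasDerivAt (contr ε) (-ε * contr ε t ^ 2) t := by
  have h1 : HasDerivAt (fun t : ℝ => 1 + ε * t) ε t := by
    simpa using ((hasDerivAt_id t).const_mul ε).const_add 1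
  refine (h1.inv h.ne').congr_deriv ?_
  simp only [contr]
  field_simp

theorem hasDerivAt_contr_rpow {ε t : ℝ} (h : 0 < 1 + ε * t) (x : ℝ) :
    HasDerivAt (fun t => contr ε t ^ x) (-ε * x * contr ε t ^ (x + 1)) t := by
  have hA := contr_pos h
  refine ((hasDerivAt_contr h).rpow_const (p := x) (Or.inl hA.ne')).congr_deriv ?_
  have : contr ε t ^ (x + 1) = contr ε t ^ (x - 1) * contr ε t ^ 2 := by
    rw [← Real.rpow_add_natCast hA.ne']
    congr 1
    push_cast
    ring
  rw [this]
  ring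

theorem hasDerivAt_mul_contr {ε t : ℝ} (h : 0 < 1 + ε * t) :
    HasDerivAt (fun t => t * contr ε t) (contr ε t ^ 2) t := by
  refine ((hasDerivAt_id t).mul (hasDerivAt_contr h)).congr_deriv ?_
  have := contr_mul h
  simp only [id]
  linear_combination -contr ε t * this

/-- This is the equation read on coefficients, from A' = -εA² and (tA)' = A². The condition 0 < 1 +
εt holds on both sides of t = 0, so the coefficients have a two-sided derivative there as well. -/
theorem MinType.hasDerivAt_flowCoeff {θ ε : ℝ} (hθ : 0 ≤ θ) {a : ℕ → ℂ} (ha : MinType a) (k : ℕ)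
    {t : ℝ} (ht : 0 < 1 + ε * t) :
    HasDerivAt (flowCoeff θ ε a k) (((θ + k : ℝ) : ℂ) * flowCoeff θ ε a (k + 1) t) t := by
  have hA := contr_pos ht
  have hj : ∀ j ∈ range (k + 1), HasDerivAt
      (fun t : ℝ => (k.choose j : ℂ) * (-(ε : ℂ)) ^ (k - j) *
        ((((contr ε t) ^ (θ + k + j) : ℝ) : ℂ) * heatCoeff θ a j ((t * contr ε t : ℝ) : ℂ)))
      ((k.choose j : ℂ) * (-(ε : ℂ)) ^ (k - j) *
        (((-ε * (θ + k + j) * contr ε t ^ (θ + k + j + 1) : ℝ) : ℂ) *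
          heatCoeff θ a j ((t * contr ε t : ℝ) : ℂ) +
          (((contr ε t) ^ (θ + k + j) : ℝ) : ℂ) * ((contr ε t ^ 2 : ℝ) •
            (((θ + j : ℝ) : ℂ) * heatCoeff θ a (j + 1) ((t * contr ε t : ℝ) : ℂ))))) t := by
    intro j _
    exact ((hasDerivAt_contr_rpow ht (θ + k + j)).ofReal_comp.mul
      (((ha.hasDerivAt_heatCoeff hθ j _).comp_ofReal).scomp t (hasDerivAt_mul_contr ht))).const_mul
        _
  have hsum := HasDerivAt.fun_sum hj
  refine hsum.congr_deriv (Eq.symm ?_)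
  set X : ℕ → ℂ := fun j => (-(ε : ℂ)) ^ (k + 1 - j) *
    ((((contr ε t) ^ (θ + k + 1 + j) : ℝ) : ℂ) * heatCoeff θ a j ((t * contr ε t : ℝ) : ℂ)) with hX
  have e := sum_choose_step θ k X
  have e2 : flowCoeff θ ε a (k + 1) t = ∑ j ∈ range (k + 2), ((k + 1).choose j : ℂ) * X j := by
    refine sum_congr rfl fun j _ => ?_
    rw [hX]
    push_cast
    simp only [add_assoc, mul_assoc]
  rw [e2]
  push_cast at e ⊢
  rw [← e]
  refine sum_congr rfl fun j hj => ?_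
  have hjk : j ≤ k := Nat.lt_succ_iff.1 (mem_range.1 hj)
  have s1 : k + 1 - j = (k - j) + 1 := by omega
  have s2 : k + 1 - (j + 1) = k - j := by omega
  have r1 : θ + k + j + 1 = θ + k + 1 + j := by ring
  have r2 : contr ε t ^ (θ + k + 1 + ((j + 1 : ℕ) : ℝ)) =
      contr ε t ^ (θ + k + j) * contr ε t ^ 2 := by
    rw [← Real.rpow_add_natCast hA.ne']
    congr 1
    push_cast
    ring
  simp only [hX]
  rw [s1, s2, r1, r2, Complex.real_smul]
  push_cast
  ring

/-! ### The derivative in t -/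

/-- The mean value inequality is used twice; the crude constant L in place of L/2 is enough. -/
theorem norm_sub_sub_smul_le {u v w : ℝ → ℂ} {s : Set ℝ} (hs : Convex ℝ s)
    (hu : ∀ x ∈ s, HasDerivAt u (v x) x) (hv : ∀ x ∈ s, HasDerivAt v (w x) x) {L : ℝ}
    (hL : ∀ x ∈ s, ‖w x‖ ≤ L) {t τ : ℝ} (ht : t ∈ s) (hτ : τ ∈ s) :
    ‖u τ - u t - (τ - t) • v t‖ ≤ L * |τ - t| ^ 2 := by
  have h0 : 0 ≤ L := (norm_nonneg _).trans (hL t ht)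
  have hseg : Set.uIcc t τ ⊆ s := by
    rw [← segment_eq_uIcc]
    exact hs.segment_subset ht hτ
  have h1 : ∀ x ∈ Set.uIcc t τ, ‖v x - v t‖ ≤ L * |τ - t| := by
    intro x hx
    have := hs.norm_image_sub_le_of_norm_hasDerivWithin_le
      (fun y hy => (hv y hy).hasDerivWithinAt) hL ht (hseg hx)
    rw [Real.norm_eq_abs] at this
    refine this.trans (mul_le_mul_of_nonneg_left ?_ h0)
    exact Set.abs_sub_left_of_mem_uIcc hx
  have h2 := (convex_uIcc t τ).norm_image_sub_le_of_norm_hasDerivWithin_le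
    (f := fun x => u x - (x - t) • v t) (f' := fun x => v x - v t) (C := L * |τ - t|)
    (fun y hy => (((hu y (hseg hy)).sub
      (((hasDerivAt_id y).sub_const t).smul_const (v t))).congr_deriv
        (by simp)).hasDerivWithinAt) h1 Set.left_mem_uIcc Set.right_mem_uIcc
  simp only [sub_self, zero_smul, sub_zero, Real.norm_eq_abs] at h2
  calc ‖u τ - u t - (τ - t) • v t‖ = ‖u τ - (τ - t) • v t - u t‖ := by congr 1; ring
    _ ≤ _ := h2
    _ = _ := by ring

theorem exists_quadratic_mul_pow_le (θ : ℝ) {r : ℝ} (hr : 0 ≤ r) (hr1 : r < 1) :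
    ∃ M, ∀ k : ℕ, (θ + k) * (θ + k + 1) * r ^ k ≤ M := by
  have habs : |r| < 1 := by rwa [abs_of_nonneg hr]
  have h0 := tendsto_pow_const_mul_const_pow_of_abs_lt_one 0 habs
  have h1 := tendsto_pow_const_mul_const_pow_of_abs_lt_one 1 habs
  have h2 := tendsto_pow_const_mul_const_pow_of_abs_lt_one 2 habs
  have h := (h2.add (h1.const_mul (2 * θ + 1))).add (h0.const_mul (θ * (θ + 1)))
  obtain ⟨M, hM⟩ := h.bddAbove_range
  refine ⟨M, fun k => le_trans (le_of_eq ?_) (hM ⟨k, rfl⟩)⟩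
  simp only
  ring

/-- The coefficients of the remainder of the difference quotient in `t`. -/
noncomputable def quotCoeff (θ ε : ℝ) (a : ℕ → ℂ) (t τ : ℝ) (k : ℕ) : ℂ :=
  ((τ : ℂ) - (t : ℂ))⁻¹ * (flowCoeff θ ε a k τ - flowCoeff θ ε a k t) -
    ((θ + k : ℝ) : ℂ) * flowCoeff θ ε a (k + 1) t

/-- The second derivative of the k-th coefficient costs a factor (θ + k)(θ + k + 1) and an index
shift by 2. Both are absorbed in passing from a rate b' with ε < b' < b to the rate b. The resulting
error O(|τ - t|) controls the norm and the pointwise values at once. -/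
theorem MinType.exists_geomBound_quotCoeff {θ ε : ℝ} (hθ : 0 ≤ θ) (hε : 0 ≤ ε) {a : ℕ → ℂ}
    (ha : MinType a) {t b : ℝ} (ht : 0 ≤ t) (hb : ε < b) :
    ∃ M, ∀ τ : ℝ, 0 ≤ τ → τ ≤ t + 1 → τ ≠ t →
      GeomBound (M * |τ - t|) b (quotCoeff θ ε a t τ) := by
  obtain ⟨b', hb1, hb2⟩ := exists_between hb
  have hb'0 : 0 < b' := hε.trans_lt hb1
  have hb0 : 0 < b := hb'0.trans hb2
  obtain ⟨K, hK⟩ := ha.exists_bound_flowCoeff hθ hε (T := t + 1) (by positivity) hb1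
  have hK0 : 0 ≤ K := (hK t ht (by linarith)).nonneg
  obtain ⟨M, hM⟩ := exists_quadratic_mul_pow_le θ (r := b' / b) (by positivity)
    ((div_lt_one hb0).2 hb2)
  refine ⟨K * b' ^ 2 * M, fun τ hτ hτ1 hne k => ?_⟩
  have hpos : ∀ s ∈ Set.Icc (0 : ℝ) (t + 1), 0 < 1 + ε * s := fun s hs => by
    have := mul_nonneg hε hs.1
    linarith
  have hd1 : ∀ s ∈ Set.Icc (0 : ℝ) (t + 1), HasDerivAt (flowCoeff θ ε a k)
      (((θ + k : ℝ) : ℂ) * flowCoeff θ ε a (k + 1) s) s :=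
    fun s hs => ha.hasDerivAt_flowCoeff hθ k (hpos s hs)
  have hd2 : ∀ s ∈ Set.Icc (0 : ℝ) (t + 1),
      HasDerivAt (fun s => ((θ + k : ℝ) : ℂ) * flowCoeff θ ε a (k + 1) s)
      (((θ + k : ℝ) : ℂ) * (((θ + (k + 1 : ℕ) : ℝ) : ℂ) * flowCoeff θ ε a (k + 1 + 1) s)) s :=
    fun s hs => (ha.hasDerivAt_flowCoeff hθ (k + 1) (hpos s hs)).const_mul _
  have hL : ∀ s ∈ Set.Icc (0 : ℝ) (t + 1),
      ‖((θ + k : ℝ) : ℂ) * (((θ + (k + 1 : ℕ) : ℝ) : ℂ) * flowCoeff θ ε a (k + 1 + 1) s)‖ ≤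
        K * b' ^ 2 * M * b ^ k := by
    intro s hs
    rw [norm_mul, norm_mul, Complex.norm_real, Complex.norm_real,
      Real.norm_of_nonneg (by positivity), Real.norm_of_nonneg (by positivity)]
    have h1 := hK s hs.1 hs.2 (k + 1 + 1)
    have h2 := hM k
    calc _ ≤ (θ + k) * ((θ + (k + 1 : ℕ)) * (K * b' ^ (k + 1 + 1))) := by gcongr
      _ = K * b' ^ 2 * ((θ + k) * (θ + k + 1) * (b' / b) ^ k) * b ^ k := by
        rw [div_pow]
        push_cast
        field_simp
        ring
      _ ≤ _ := by gcongr
  have key := norm_sub_sub_smul_le (convex_Icc (0 : ℝ) (t + 1)) hd1 hd2 hL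
    (t := t) (τ := τ) ⟨ht, by linarith⟩ ⟨hτ, hτ1⟩
  have hne' : 0 < |τ - t| := abs_pos.2 (sub_ne_zero.2 hne)
  have hneC : (τ : ℂ) - (t : ℂ) ≠ 0 := by
    rw [← Complex.ofReal_sub]
    exact_mod_cast sub_ne_zero.2 hne
  have e : quotCoeff θ ε a t τ k = ((τ : ℂ) - (t : ℂ))⁻¹ * (flowCoeff θ ε a k τ -
      flowCoeff θ ε a k t - (τ - t) • (((θ + k : ℝ) : ℂ) * flowCoeff θ ε a (k + 1) t)) := by
    rw [quotCoeff, Complex.real_smul]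
    push_cast
    field_simp
  rw [e, norm_mul, norm_inv, ← Complex.ofReal_sub, Complex.norm_real, Real.norm_eq_abs,
    inv_mul_le_iff₀ hne']
  refine key.trans (le_of_eq ?_)
  ring

section Flow

variable {θ ε : ℝ} {g h : ℂ → ℂ}

theorem egf_quotCoeff (hθ : 0 ≤ θ) (hε : 0 ≤ ε) (hh : h ∈ spaceA 0)
    (hg : ∀ z : ℂ, g z = Complex.exp (-(ε : ℂ) * z) * h z) {t τ : ℝ} (ht : 0 ≤ t) (hτ : 0 ≤ τ) :
    (fun z : ℂ => (expDelta θ τ g z - expDelta θ t g z) / ((τ : ℂ) - (t : ℂ)) -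
      deltaOp θ (expDelta θ t g) z) = egf (quotCoeff θ ε (fun n => iteratedDeriv n h 0) t τ) := by
  have ha := minType_of_mem_spaceA hh
  have hs : ∀ s : ℝ, 0 ≤ s → EgfSummable fun k =>
      flowCoeff θ ε (fun n => iteratedDeriv n h 0) k s := by
    intro s hs
    obtain ⟨K, hK⟩ := ha.exists_bound_flowCoeff hθ hε hs (lt_add_one ε)
    exact (hK s hs le_rfl).egfSummable
  have hs2 : EgfSummable fun k => ((θ + k : ℝ) : ℂ) *
      flowCoeff θ ε (fun n => iteratedDeriv n h 0) (k + 1) t := by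
    have h1 := ((hs t ht).shift.const_mul (θ : ℂ))
    have h2 := (hs t ht).shift.natCast_mul
    intro R hR
    refine Summable.of_nonneg_of_le (fun k => by positivity) (fun k => ?_)
      ((h1 R hR).add (h2 R hR))
    rw [← add_div, ← add_mul]
    gcongr
    push_cast
    rw [add_mul]
    exact norm_add_le _ _
  have hs3 : EgfSummable fun k => flowCoeff θ ε (fun n => iteratedDeriv n h 0) k τ -
      flowCoeff θ ε (fun n => iteratedDeriv n h 0) k t := by
    intro R hR
    refine Summable.of_nonneg_of_le (fun k => by positivity) (fun k => ?_)
      ((hs τ hτ R hR).add (hs t ht R hR))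
    rw [← add_div, ← add_mul]
    gcongr
    exact norm_sub_le _ _
  funext z
  rw [expDelta_eq_egf_flowCoeff hθ hε hh hg ht, expDelta_eq_egf_flowCoeff hθ hε hh hg hτ,
    (hs t ht).deltaOp_egf]
  unfold quotCoeff
  rw [(hs3.const_mul _).egf_sub hs2, egf_const_mul, (hs τ hτ).egf_sub (hs t ht)]
  rw [div_eq_inv_mul]

theorem expDelta_mem_spaceA (hθ : 0 ≤ θ) (hε : 0 ≤ ε) (hh : h ∈ spaceA 0)
    (hg : ∀ z : ℂ, g z = Complex.exp (-(ε : ℂ) * z) * h z) {t : ℝ} (ht : 0 ≤ t) :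
    expDelta θ t g ∈ spaceA ε := by
  rw [expDelta_eq_egf_flowCoeff hθ hε hh hg ht]
  refine egf_mem_spaceA hε fun b hb => ?_
  obtain ⟨K, hK⟩ := (minType_of_mem_spaceA hh).exists_bound_flowCoeff hθ hε ht hb
  exact ⟨K, hK t ht le_rfl⟩

theorem eventually_nhdsWithin_Ici (t : ℝ) : ∀ᶠ τ in 𝓝[Set.Ici (0 : ℝ) \ {t}] t,
    0 ≤ τ ∧ τ ≤ t + 1 ∧ τ ≠ t := by
  filter_upwards [self_mem_nhdsWithin,
    mem_nhdsWithin_of_mem_nhds (Iic_mem_nhds (lt_add_one t))] with τ h1 h2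
  exact ⟨h1.1, h2, h1.2⟩

theorem tendsto_mul_abs_sub (M : ℝ) (t : ℝ) (s : Set ℝ) :
    Tendsto (fun τ => M * |τ - t|) (𝓝[s] t) (𝓝 0) := by
  have h : Continuous fun τ : ℝ => M * |τ - t| := by fun_prop
  have := (h.tendsto t).mono_left (nhdsWithin_le_nhds (s := s))
  simpa using this

theorem tendsto_expTypeNorm_quot (hθ : 0 ≤ θ) (hε : 0 ≤ ε) (hh : h ∈ spaceA 0)
    (hg : ∀ z : ℂ, g z = Complex.exp (-(ε : ℂ) * z) * h z) {t b : ℝ} (ht : 0 ≤ t) (hb : ε < b) :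
    Tendsto (fun τ : ℝ => expTypeNorm b (fun z : ℂ =>
          (expDelta θ τ g z - expDelta θ t g z) / ((τ : ℂ) - (t : ℂ)) -
            deltaOp θ (expDelta θ t g) z))
        (𝓝[Set.Ici 0 \ {t}] t) (𝓝 0) := by
  obtain ⟨M, hM⟩ := (minType_of_mem_spaceA hh).exists_geomBound_quotCoeff hθ hε ht hb
  have h0 := ENNReal.tendsto_ofReal (tendsto_mul_abs_sub M t (Set.Ici 0 \ {t}))
  rw [ENNReal.ofReal_zero] at h0
  refine tendsto_of_tendsto_of_tendsto_of_le_of_le' tendsto_const_nhds h0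
    (Eventually.of_forall fun _ => zero_le) ?_
  filter_upwards [eventually_nhdsWithin_Ici t] with τ hτ
  have hq := hM τ hτ.1 hτ.2.1 hτ.2.2
  rw [egf_quotCoeff hθ hε hh hg ht hτ.1]
  refine expTypeNorm_le_ofReal (hε.trans_lt hb) ?_
  simpa only [hq.egfSummable.iteratedDeriv_zero] using hq

theorem hasDerivWithinAt_expDelta (hθ : 0 ≤ θ) (hε : 0 ≤ ε) (hh : h ∈ spaceA 0)
    (hg : ∀ z : ℂ, g z = Complex.exp (-(ε : ℂ) * z) * h z) {t : ℝ} (ht : 0 ≤ t) (z : ℂ) :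
    HasDerivWithinAt (fun τ : ℝ => expDelta θ τ g z) (deltaOp θ (expDelta θ t g) z)
      (Set.Ici 0) t := by
  obtain ⟨M, hM⟩ :=
    (minType_of_mem_spaceA hh).exists_geomBound_quotCoeff hθ hε ht (lt_add_one ε)
  rw [hasDerivWithinAt_iff_tendsto_slope, tendsto_iff_norm_sub_tendsto_zero]
  have h0 := (tendsto_mul_abs_sub M t (Set.Ici 0 \ {t})).mul_const (Real.exp ((ε + 1) * ‖z‖))
  rw [zero_mul] at h0
  refine tendsto_of_tendsto_of_tendsto_of_le_of_le' tendsto_const_nhds h0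
    (Eventually.of_forall fun _ => norm_nonneg _) ?_
  filter_upwards [eventually_nhdsWithin_Ici t] with τ hτ
  have hq := hM τ hτ.1 hτ.2.1 hτ.2.2
  refine le_trans (le_of_eq ?_) (hq.norm_egf_le z)
  rw [← egf_quotCoeff hθ hε hh hg ht hτ.1, slope_def_module, Complex.real_smul]
  beta_reduce
  rw [div_eq_inv_mul]
  push_cast
  rfl

/-! ### Decay as t → ∞ -/

theorem GeomBound.norm_egf_mul_le {K b : ℝ} {c : ℕ → ℂ} (hc : GeomBound K b c) (h0 : c 0 = 0)
    {q : ℝ} (hq : 0 ≤ q) (hq1 : q ≤ 1) (z : ℂ) :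
    ‖egf c ((q : ℂ) * z)‖ ≤ q * (K * Real.exp (b * ‖z‖)) := by
  refine tsum_of_norm_bounded (((hasSum_exp_real (b * ‖z‖)).mul_left K).mul_left q) fun j => ?_
  rcases Nat.eq_zero_or_pos j with rfl | hj
  · have := hc.nonneg
    simp only [h0]
    simp
    positivity
  · rw [norm_egf_term, norm_mul, Complex.norm_real, Real.norm_of_nonneg hq, mul_pow]
    have h1 : q ^ j ≤ q := pow_le_of_le_one hq hq1 hj.ne'
    calc ‖c j‖ * (q ^ j * ‖z‖ ^ j) / (j.factorial : ℝ)
        ≤ ‖c j‖ * (q * ‖z‖ ^ j) / (j.factorial : ℝ) := by gcongr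
      _ = q * (‖c j‖ * ‖z‖ ^ j / (j.factorial : ℝ)) := by ring
      _ ≤ _ := by
        gcongr
        exact hc.term_le (norm_nonneg z) j

theorem tendsto_contr {ε : ℝ} (hε : 0 < ε) : Tendsto (contr ε) atTop (𝓝 0) :=
  (tendsto_atTop_add_const_left _ 1 (tendsto_id.const_mul_atTop hε)).inv_tendsto_atTop

theorem mul_contr_le {ε t : ℝ} (hε : 0 < ε) (ht : 0 ≤ t) : t * contr ε t ≤ 1 / ε := by
  rw [contr, ← div_eq_mul_inv, div_le_div_iff₀ (by positivity) hε]
  linarith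

/-- Since tA ≤ 1 / ε, the heat coefficients of `h` at time tA obey one bound for all t, while A → 0.
If θ > 0, the prefactor A^θ gives the decay. If θ = 0, then h(0) = 0, and the constant coefficient
stays 0 because (0)_k = 0 for k ≥ 1; the argument A² z then contributes a factor A². -/
theorem tendstoUniformlyOn_expDelta_zero (hθ : 0 ≤ θ) (hε : 0 < ε) (hh : h ∈ spaceA 0)
    (hg : ∀ z : ℂ, g z = Complex.exp (-(ε : ℂ) * z) * h z) (hor : 0 < θ ∨ g 0 = 0)
    {s : Set ℂ} (hs : IsCompact s) :
    TendstoUniformlyOn (fun t : ℝ => expDelta θ t g) (fun _ => 0) atTop s := by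
  obtain ⟨R, hR⟩ := hs.isBounded.exists_norm_le
  have ha := minType_of_mem_spaceA hh
  obtain ⟨K, hK⟩ := ha.exists_bound_heatCoeff hθ (T := 1 / ε) (δ := 1) (by positivity) one_pos
  have hK0 : 0 ≤ K := (hK 0 (by simp; positivity)).nonneg
  suffices H : ∃ φ : ℝ → ℝ, Tendsto φ atTop (𝓝 0) ∧ ∀ t : ℝ, 0 ≤ t → ∀ z : ℂ, ‖z‖ ≤ R →
      ‖expDelta θ t g z‖ ≤ φ t by
    obtain ⟨φ, hφ, hle⟩ := H
    rw [Metric.tendstoUniformlyOn_iff]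
    intro e he
    filter_upwards [hφ.eventually_lt_const he, eventually_ge_atTop 0] with t h1 h2 z hz
    rw [dist_zero_left]
    exact (hle t h2 z (hR z hz)).trans_lt h1
  have hexp : ∀ t : ℝ, 0 ≤ t → ∀ z : ℂ, ‖z‖ ≤ R →
      ‖Complex.exp (-((ε * contr ε t : ℝ) : ℂ) * z)‖ ≤ Real.exp (ε * R) := by
    intro t ht z hz
    have hA := contr_pos (ε := ε) (t := t) (by positivity)
    refine (Complex.norm_exp_le_exp_norm _).trans (Real.exp_le_exp.2 ?_)
    rw [norm_mul, norm_neg, Complex.norm_real, Real.norm_of_nonneg (by positivity)]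
    have := contr_le_one hε.le ht
    calc ε * contr ε t * ‖z‖ ≤ ε * 1 * R := by gcongr
      _ = ε * R := by ring
  have hnorm : ∀ t : ℝ, 0 ≤ t → ‖((t * contr ε t : ℝ) : ℂ)‖ ≤ 1 / ε := by
    intro t ht
    have hA := contr_pos (ε := ε) (t := t) (by positivity)
    rw [Complex.norm_real, Real.norm_of_nonneg (by positivity)]
    exact mul_contr_le hε ht
  have hform : ∀ t : ℝ, 0 ≤ t → ∀ z : ℂ, expDelta θ t g z = (((contr ε t) ^ θ : ℝ) : ℂ) *
      (Complex.exp (-((ε * contr ε t : ℝ) : ℂ) * z) *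
        egf (fun j => heatCoeff θ (fun n => iteratedDeriv n h 0) j ((t * contr ε t : ℝ) : ℂ))
          (((contr ε t ^ 2 : ℝ) : ℂ) * z)) := by
    intro t ht z
    have hA := contr_pos (ε := ε) (t := t) (by positivity)
    rw [expDelta_exp_mul hε.le ht hg, expDelta_eq_egf_of_mem_spaceA_zero hθ hh (by positivity)]
    push_cast
    rfl
  rcases hθ.eq_or_lt with rfl | hθ0
  · have hg0 : h 0 = 0 := by
      have : g 0 = 0 := hor.resolve_left (lt_irrefl _)
      simpa [hg] using this
    refine ⟨fun t => Real.exp (ε * R) * (contr ε t ^ 2 * (K * Real.exp (1 * R))), ?_,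
      fun t ht z hz => ?_⟩
    · have h1 := (((tendsto_contr hε).pow 2).mul_const (K * Real.exp (1 * R))).const_mul
        (Real.exp (ε * R))
      simpa using h1
    · have hA := contr_pos (ε := ε) (t := t) (by positivity)
      have hA1 := contr_le_one hε.le ht
      rw [hform t ht z, Real.rpow_zero, Complex.ofReal_one, one_mul, norm_mul]
      have h0 : heatCoeff 0 (fun n => iteratedDeriv n h 0) 0 ((t * contr ε t : ℝ) : ℂ) = 0 := by
        have hz : ∀ k : ℕ, (poch (0 + ((0 : ℕ) : ℝ)) k : ℂ) * iteratedDeriv (0 + k) h 0 = 0 := by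
          intro k
          rcases Nat.eq_zero_or_pos k with rfl | hk
          · simp [hg0]
          · simp [poch_zero_left hk.ne']
        simp only [heatCoeff, egf, hz, zero_mul, zero_div, tsum_zero]
      have h1 := (hK _ (hnorm t ht)).norm_egf_mul_le h0 (q := contr ε t ^ 2) (by positivity)
        (pow_le_one₀ hA.le hA1) z
      refine mul_le_mul (hexp t ht z hz) (h1.trans ?_) (norm_nonneg _) (Real.exp_pos _).le
      gcongr
  · refine ⟨fun t => contr ε t ^ θ * (Real.exp (ε * R) * (K * Real.exp (1 * R))), ?_,
      fun t ht z hz => ?_⟩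
    · have h1 := ((tendsto_contr hε).rpow_const (Or.inr hθ)).mul_const
        (Real.exp (ε * R) * (K * Real.exp (1 * R)))
      simpa [Real.zero_rpow hθ0.ne'] using h1
    · have hA := contr_pos (ε := ε) (t := t) (by positivity)
      have hA1 := contr_le_one hε.le ht
      rw [hform t ht z, norm_mul, norm_mul, Complex.norm_real,
        Real.norm_of_nonneg (by positivity)]
      have h1 := (hK _ (hnorm t ht)).norm_egf_le (((contr ε t ^ 2 : ℝ) : ℂ) * z)
      refine mul_le_mul_of_nonneg_left (mul_le_mul (hexp t ht z hz) (h1.trans ?_)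
        (norm_nonneg _) (Real.exp_pos _).le) (by positivity)
      gcongr
      rw [norm_mul, Complex.norm_real, Real.norm_of_nonneg (by positivity)]
      calc contr ε t ^ 2 * ‖z‖ ≤ 1 * ‖z‖ := by
            gcongr
            exact pow_le_one₀ hA.le hA1
        _ ≤ R := by rwa [one_mul]

end Flow

/-! ### Polynomials with nonpositive roots -/

/-- A nonzero polynomial all of whose roots lie in `(-∞, 0]`. -/
def NonposRooted (p : Polynomial ℂ) : Prop :=
  p ≠ 0 ∧ ∀ r : ℂ, p.IsRoot r → r.im = 0 ∧ r.re ≤ 0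

theorem im_one_div_sub {z r : ℂ} (hr : r.im = 0) :
    (1 / (z - r)).im = -z.im / Complex.normSq (z - r) := by
  rw [one_div, Complex.inv_im, Complex.sub_im, hr, sub_zero]

theorem Multiset.im_sum_map (s : Multiset ℂ) (f : ℂ → ℂ) :
    (s.map f).sum.im = (s.map fun r => (f r).im).sum := by
  induction s using Multiset.induction_on with
  | empty => simp
  | cons a s ih => simp [ih]

theorem Multiset.re_sum_map (s : Multiset ℂ) (f : ℂ → ℂ) :
    (s.map f).sum.re = (s.map fun r => (f r).re).sum := by
  induction s using Multiset.induction_on with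
  | empty => simp
  | cons a s ih => simp [ih]

theorem Multiset.sum_map_nonneg_of_forall (s : Multiset ℂ) (f : ℂ → ℝ) (h : ∀ r ∈ s, 0 ≤ f r) :
    0 ≤ (s.map f).sum := by
  refine Multiset.sum_nonneg fun x hx => ?_
  obtain ⟨r, hr, rfl⟩ := Multiset.mem_map.1 hx
  exact h r hr

theorem Multiset.sum_map_pos_of_forall {s : Multiset ℂ} (hs : s ≠ 0) (f : ℂ → ℝ)
    (h : ∀ r ∈ s, 0 < f r) : 0 < (s.map f).sum := by
  obtain ⟨a, ha⟩ := Multiset.exists_mem_of_ne_zero hs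
  obtain ⟨t, rfl⟩ := Multiset.exists_cons_of_mem ha
  rw [Multiset.map_cons, Multiset.sum_cons]
  have h1 := Multiset.sum_map_nonneg_of_forall t f fun r hr =>
    (h r (Multiset.mem_cons_of_mem hr)).le
  have h2 := h a ha
  linarith

namespace NonposRooted

variable {p : Polynomial ℂ}

theorem eval_ne_zero (hp : NonposRooted p) {z : ℂ} (hz : z.im ≠ 0 ∨ 0 < z.re) : p.eval z ≠ 0 := by
  intro h
  have := hp.2 z h
  rcases hz with hz | hz
  · exact hz this.1
  · linarith [this.2]

theorem of_mem_roots (hp : NonposRooted p) {r : ℂ} (hr : r ∈ p.roots) : r.im = 0 ∧ r.re ≤ 0 :=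
  hp.2 r (Polynomial.isRoot_of_mem_roots hr)

theorem roots_ne_zero (hd : p.natDegree ≠ 0) : p.roots ≠ 0 := by
  intro h
  have h1 := (Polynomial.splits_iff_card_roots (f := p)).1 (IsAlgClosed.splits p)
  rw [h, Multiset.card_zero] at h1
  exact hd h1.symm

theorem logDeriv_eq (hp : NonposRooted p) {z : ℂ} (hz : z.im ≠ 0 ∨ 0 < z.re) :
    p.derivative.eval z / p.eval z = (p.roots.map fun r => 1 / (z - r)).sum :=
  (IsAlgClosed.splits p).eval_derivative_div_eval_of_ne_zero (hp.eval_ne_zero hz)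

/-- For a real root r, each summand 1 / (z - r) has imaginary part of sign opposite to that of Im z.
-/
theorem im_logDeriv (hp : NonposRooted p) (hd : p.natDegree ≠ 0) {z : ℂ} (hz : z.im ≠ 0) :
    z.im * (p.derivative.eval z / p.eval z).im < 0 := by
  rw [hp.logDeriv_eq (Or.inl hz), Multiset.im_sum_map, ← Multiset.sum_map_mul_left, ← neg_pos,
    ← Multiset.sum_map_neg]
  refine Multiset.sum_map_pos_of_forall (roots_ne_zero hd) _ fun r hr => ?_
  have hr' := hp.of_mem_roots hr
  have hne : z - r ≠ 0 := by
    intro h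
    rw [sub_eq_zero.1 h] at hz
    exact hz hr'.1
  have := Complex.normSq_pos.2 hne
  rw [im_one_div_sub hr'.1]
  have h2 : 0 < z.im * z.im := mul_self_pos.2 hz
  rw [mul_div_assoc', mul_neg, neg_div, neg_neg]
  positivity

theorem re_logDeriv (hp : NonposRooted p) (hd : p.natDegree ≠ 0) {z : ℂ}
    (hz0 : 0 < z.re) : 0 < (p.derivative.eval z / p.eval z).re := by
  rw [hp.logDeriv_eq (Or.inr hz0), Multiset.re_sum_map]
  refine Multiset.sum_map_pos_of_forall (roots_ne_zero hd) _ fun r hr => ?_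
  have hr' := hp.of_mem_roots hr
  have h1 : 0 < (z - r).re := by rw [Complex.sub_re]; linarith [hr'.2]
  have hne : z - r ≠ 0 := fun h => by rw [h] at h1; simp at h1
  have := Complex.normSq_pos.2 hne
  rw [one_div, Complex.inv_re]
  positivity

/-- The imaginary part of z / (z - r) is -r Im z / |z - r|², so off the real axis this is where r ≤
0, and not only r real, is used. -/
theorem im_mul_logDeriv (hp : NonposRooted p) {z : ℂ} (hz : z.im ≠ 0) :
    0 ≤ z.im * (z * (p.derivative.eval z / p.eval z)).im := by
  rw [hp.logDeriv_eq (Or.inl hz), ← Multiset.sum_map_mul_left, Multiset.im_sum_map,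
    ← Multiset.sum_map_mul_left]
  refine Multiset.sum_map_nonneg_of_forall _ _ fun r hr => ?_
  have hr' := hp.of_mem_roots hr
  have e : z.im * (z * (1 / (z - r))).im =
      z.im ^ 2 * (-r.re) / Complex.normSq (z - r) := by
    rw [mul_one_div, Complex.div_im, Complex.sub_re, Complex.sub_im, hr'.1]
    ring
  rw [e]
  have := Complex.normSq_nonneg (z - r)
  have := hr'.2
  exact div_nonneg (mul_nonneg (sq_nonneg _) (by linarith)) (by assumption)

theorem derivative_eval_ne_zero (hp : NonposRooted p) (hd : p.natDegree ≠ 0) {z : ℂ}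
    (hz : z.im ≠ 0 ∨ 0 < z.re) : p.derivative.eval z ≠ 0 := by
  intro h
  by_cases hz' : z.im = 0
  · have := hp.re_logDeriv hd (hz.resolve_left (not_not.2 hz'))
    simp [h] at this
  · have := hp.im_logDeriv hd hz'
    simp [h] at this

theorem of_eval_ne_zero {q : Polynomial ℂ}
    (h : ∀ z : ℂ, (z.im ≠ 0 ∨ 0 < z.re) → q.eval z ≠ 0) : NonposRooted q := by
  refine ⟨?_, fun r hr => ?_⟩
  · rintro rfl
    exact h 1 (Or.inr (by simp)) (by simp)
  · by_contra hcon
    refine h r ?_ hr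
    by_cases h0 : r.im = 0
    · right
      by_contra h1
      exact hcon ⟨h0, not_lt.1 h1⟩
    · exact Or.inl h0

theorem derivative (hp : NonposRooted p) (hd : p.natDegree ≠ 0) :
    NonposRooted (Polynomial.derivative p) :=
  of_eval_ne_zero fun _ hz => hp.derivative_eval_ne_zero hd hz

end NonposRooted

/-- The operator `Δ_θ` on polynomials. -/
noncomputable def deltaPoly (θ : ℝ) : Module.End ℂ (Polynomial ℂ) :=
  (θ : ℂ) • Polynomial.derivative +
    LinearMap.mulLeft ℂ Polynomial.X ∘ₗ Polynomial.derivative ∘ₗ Polynomial.derivative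

theorem deltaPoly_apply (θ : ℝ) (p : Polynomial ℂ) : deltaPoly θ p =
    (θ : ℂ) • Polynomial.derivative p +
      Polynomial.X * Polynomial.derivative (Polynomial.derivative p) := rfl

/-- At a zero, division by p' gives p / p' + a (θ + z p'' / p') = 0. Off the real axis Im(p / p')
has strictly the sign of Im z, and the second summand has weakly the same sign; at z > 0 the same
comparison works with real parts. Thus no zero exists outside (-∞, 0]. -/
theorem NonposRooted.add_deltaPoly {p : Polynomial ℂ} (hp : NonposRooted p) {θ a : ℝ} (hθ : 0 ≤ θ)
    (ha : 0 ≤ a) : NonposRooted (p + (a : ℂ) • deltaPoly θ p) := by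
  by_cases hd : p.natDegree = 0
  · have h0 : deltaPoly θ p = 0 := by
      rw [deltaPoly_apply, Polynomial.derivative_of_natDegree_zero hd]
      simp
    rwa [h0, smul_zero, add_zero]
  refine NonposRooted.of_eval_ne_zero fun z hz h0 => ?_
  have hp' := hp.derivative hd
  have hpz := hp.eval_ne_zero hz
  have hp'z := hp'.eval_ne_zero hz
  set q := Polynomial.derivative p with hq
  rw [deltaPoly_apply, ← hq] at h0
  simp only [Polynomial.eval_add, Polynomial.eval_smul, Polynomial.eval_mul, Polynomial.eval_X,
    smul_eq_mul] at h0
  set S := q.eval z / p.eval z with hS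
  set W := z * ((Polynomial.derivative q).eval z / q.eval z) with hW
  have hSne : S ≠ 0 := div_ne_zero hp'z hpz
  have key : S⁻¹ + a * (θ + W) = 0 := by
    rw [hS, hW, inv_div]
    field_simp
    linear_combination h0
  have hn := Complex.normSq_pos.2 hSne
  by_cases hz' : z.im = 0
  · have hz0 := hz.resolve_left (not_not.2 hz')
    have h1 : 0 < S.re := hp.re_logDeriv hd hz0
    have h2 : 0 ≤ W.re := by
      rw [hW, Complex.mul_re, hz', zero_mul, sub_zero]
      refine mul_nonneg hz0.le ?_
      by_cases hd' : q.natDegree = 0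
      · rw [Polynomial.derivative_of_natDegree_zero hd']
        simp
      · exact (hp'.re_logDeriv hd' hz0).le
    have h3 := congrArg Complex.re key
    simp only [Complex.add_re, Complex.inv_re, Complex.re_ofReal_mul, Complex.ofReal_re,
      Complex.zero_re] at h3
    have h4 : 0 < S.re / Complex.normSq S := div_pos h1 hn
    have h5 : 0 ≤ a * (θ + W.re) := by positivity
    linarith
  · have h1 : z.im * S.im < 0 := hp.im_logDeriv hd hz'
    have h2 : 0 ≤ z.im * W.im := hp'.im_mul_logDeriv hz'
    have h3 := congrArg Complex.im key
    simp only [Complex.add_im, Complex.inv_im, Complex.im_ofReal_mul, Complex.ofReal_im,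
      Complex.zero_im, zero_add] at h3
    have h4 : 0 < -(z.im * S.im) / Complex.normSq S := div_pos (by linarith) hn
    have h5 : 0 ≤ a * (z.im * W.im) := mul_nonneg ha h2
    have h6 : -(z.im * S.im) / Complex.normSq S + a * (z.im * W.im) = 0 := by
      linear_combination z.im * h3
    linarith

theorem NonposRooted.pow_deltaPoly {p : Polynomial ℂ} (hp : NonposRooted p) {θ a : ℝ} (hθ : 0 ≤ θ)
    (ha : 0 ≤ a) (n : ℕ) :
    NonposRooted (((1 + (a : ℂ) • deltaPoly θ) ^ n : Module.End ℂ (Polynomial ℂ)) p) := by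
  induction n with
  | zero => simpa using hp
  | succ n ih =>
    rw [pow_succ']
    exact ih.add_deltaPoly hθ ha

/-! ### Limits of such polynomials -/

theorem exists_antitone_prod_of_multiset (s : Multiset ℝ) (hs : ∀ x ∈ s, 0 ≤ x ∧ x ≤ 1) :
    ∃ (γ : ℕ → ℝ) (d : ℕ), Antitone γ ∧ (∀ j, 0 ≤ γ j ∧ γ j ≤ 1) ∧ (∀ j, d ≤ j → γ j = 0) ∧
      ∀ w : ℂ, (s.map fun x : ℝ => 1 + (x : ℂ) * w).prod = ∏ j ∈ range d, (1 + (γ j : ℂ) * w) := by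
  set L := s.sort (· ≥ ·) with hL
  have hLs : (L : Multiset ℝ) = s := Multiset.sort_eq _ _
  have hsorted : L.Pairwise (· ≥ ·) := Multiset.pairwise_sort _ _
  have hmem : ∀ x ∈ L, 0 ≤ x ∧ x ≤ 1 := fun x hx => hs x (by rw [← hLs]; exact hx)
  have hbd : ∀ j, 0 ≤ L.getD j 0 ∧ L.getD j 0 ≤ 1 := by
    intro j
    by_cases hj : j < L.length
    · rw [List.getD_eq_getElem _ _ hj]
      exact hmem _ (List.getElem_mem hj)
    · rw [List.getD_eq_default _ _ (not_lt.1 hj)]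
      simp
  refine ⟨fun j => L.getD j 0, L.length, fun i j hij => ?_, hbd,
    fun j hj => List.getD_eq_default _ _ hj, fun w => ?_⟩
  · by_cases hj : j < L.length
    · have hi : i < L.length := hij.trans_lt hj
      simp only [List.getD_eq_getElem _ _ hj, List.getD_eq_getElem _ _ hi]
      rcases hij.eq_or_lt with rfl | hlt
      · exact le_rfl
      · exact List.pairwise_iff_getElem.1 hsorted i j hi hj hlt
    · simp only [List.getD_eq_default _ _ (not_lt.1 hj)]
      exact (hbd i).1
  · rw [← hLs, Multiset.map_coe, Multiset.prod_coe]
    clear_value L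
    clear hLs hsorted hmem hbd hL
    induction L with
    | nil => simp
    | cons x L ih =>
      rw [List.map_cons, List.prod_cons, ih, List.length_cons, prod_range_succ', mul_comm]
      simp

/-- The expansion is made at 1, which is never a root: 1 + w - r = (1 - r)(1 + w / (1 - r)), and 1 /
(1 - r) lies in [0, 1]. A root at 0 becomes the value 1 and needs no separate treatment, which keeps
the parameters in a compact set. -/
theorem NonposRooted.exists_factorization {p : Polynomial ℂ} (hp : NonposRooted p) :
    ∃ (γ : ℕ → ℝ) (d : ℕ), Antitone γ ∧ (∀ j, 0 ≤ γ j ∧ γ j ≤ 1) ∧ (∀ j, d ≤ j → γ j = 0) ∧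
      ∀ w : ℂ, p.eval (1 + w) = p.eval 1 * ∏ j ∈ range d, (1 + (γ j : ℂ) * w) := by
  obtain ⟨γ, d, h1, h2, h3, h4⟩ := exists_antitone_prod_of_multiset
    (p.roots.map fun r : ℂ => 1 / (1 - r.re)) (by
      intro x hx
      obtain ⟨r, hr, rfl⟩ := Multiset.mem_map.1 hx
      have := (hp.of_mem_roots hr).2
      have h0 : 0 < 1 - r.re := by linarith
      exact ⟨by positivity, by rw [div_le_one h0]; linarith⟩)
  refine ⟨γ, d, h1, h2, h3, fun w => ?_⟩
  rw [← h4 w, (IsAlgClosed.splits p).eval_eq_prod_roots, (IsAlgClosed.splits p).eval_eq_prod_roots,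
    mul_assoc, Multiset.map_map, ← Multiset.prod_map_mul]
  congr 2
  refine Multiset.map_congr rfl fun r hr => ?_
  have hr' := hp.of_mem_roots hr
  have e : r = ((r.re : ℝ) : ℂ) := Complex.ext (by simp) (by simp [hr'.1])
  have h0 : (1 : ℂ) - (r.re : ℂ) ≠ 0 := by
    have : (1 : ℝ) - r.re ≠ 0 := by linarith [hr'.2]
    exact_mod_cast this
  simp only [Function.comp_apply]
  rw [e]
  push_cast
  simp only [Complex.ofReal_re]
  field_simp
  ring

theorem norm_exp_sub_one_sub_le (x : ℂ) :
    ‖Complex.exp x - (1 + x)‖ ≤ ‖x‖ ^ 2 * Real.exp ‖x‖ := by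
  have h := (hasSum_nat_add_iff' 2).2 (hasSum_exp_complex x)
  have e : ∑ i ∈ range 2, x ^ i / (i.factorial : ℂ) = 1 + x := by simp [sum_range_succ]
  rw [e] at h
  rw [← h.tsum_eq]
  refine tsum_of_norm_bounded ((hasSum_exp_real ‖x‖).mul_left (‖x‖ ^ 2)) fun j => ?_
  rw [norm_div, norm_pow, Complex.norm_natCast, pow_add, mul_comm (‖x‖ ^ j), mul_div_assoc]
  gcongr
  omega

/-- The exponential cancels the linear term. The remaining γ² is summable uniformly along the
sequence of polynomials, whereas γ itself need not be. -/
theorem norm_one_add_mul_exp_neg_sub_one_le {γ : ℝ} (h0 : 0 ≤ γ) (h1 : γ ≤ 1) (w : ℂ) :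
    ‖(1 + (γ : ℂ) * w) * Complex.exp (-((γ : ℂ) * w)) - 1‖ ≤
      γ ^ 2 * (‖w‖ ^ 2 * Real.exp (2 * ‖w‖)) := by
  set x := (γ : ℂ) * w with hx
  have hxn : ‖x‖ = γ * ‖w‖ := by rw [hx, norm_mul, Complex.norm_real, Real.norm_of_nonneg h0]
  have hxw : ‖x‖ ≤ ‖w‖ := by
    rw [hxn]
    exact mul_le_of_le_one_left (norm_nonneg _) h1
  have e : (1 + x) * Complex.exp (-x) - 1 = -(Complex.exp (-x) * (Complex.exp x - (1 + x))) := by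
    have : Complex.exp (-x) * Complex.exp x = 1 := by rw [← Complex.exp_add]; simp
    linear_combination this
  rw [e, norm_neg, norm_mul]
  have h2 : ‖Complex.exp (-x)‖ ≤ Real.exp ‖w‖ := by
    refine (Complex.norm_exp_le_exp_norm _).trans (Real.exp_le_exp.2 ?_)
    rwa [norm_neg]
  calc ‖Complex.exp (-x)‖ * ‖Complex.exp x - (1 + x)‖
      ≤ Real.exp ‖w‖ * (‖x‖ ^ 2 * Real.exp ‖x‖) :=
        mul_le_mul h2 (norm_exp_sub_one_sub_le x) (norm_nonneg _) (Real.exp_pos _).le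
    _ ≤ Real.exp ‖w‖ * (‖x‖ ^ 2 * Real.exp ‖w‖) := by gcongr
    _ = γ ^ 2 * (‖w‖ ^ 2 * Real.exp (2 * ‖w‖)) := by
      rw [hxn, two_mul, Real.exp_add]
      ring

theorem one_add_sum_le_prod_one_add {γ : ℕ → ℝ} (hγ : ∀ j, 0 ≤ γ j) (d : ℕ) :
    1 + ∑ j ∈ range d, γ j ≤ ∏ j ∈ range d, (1 + γ j) := by
  induction d with
  | zero => simp
  | succ d ih =>
    rw [sum_range_succ, prod_range_succ]
    have h1 := hγ d
    have h2 : 0 ≤ ∑ j ∈ range d, γ j := sum_nonneg fun j _ => hγ j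
    nlinarith

/-- Sequences of polynomials with roots in `(-∞, 0]` have limits of Laguerre type, expanded at
`1`. -/
theorem exists_factorization_of_tendsto {P : ℕ → Polynomial ℂ} (hP : ∀ n, NonposRooted (P n))
    {F : ℂ → ℂ} (hF : ∀ z, Tendsto (fun n => (P n).eval z) atTop (𝓝 (F z))) (hF1 : F 1 ≠ 0) :
    ∃ (α : ℝ) (γ : ℕ → ℝ), 0 ≤ α ∧ Antitone γ ∧ (∀ j, 0 ≤ γ j ∧ γ j ≤ 1) ∧ Summable γ ∧
      ∀ w : ℂ, F (1 + w) = F 1 * (Complex.exp ((α : ℂ) * w) * ∏' j : ℕ, (1 + (γ j : ℂ) * w)) := by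
  choose γ d hanti hbd hzero hprod using fun n => (hP n).exists_factorization
  have hP1 : ∀ n, (P n).eval 1 ≠ 0 := fun n => (hP n).eval_ne_zero (Or.inr (by simp))
  have hq : ∀ w : ℂ, Tendsto (fun n => ∏ j ∈ range (d n), (1 + (γ n j : ℂ) * w)) atTop
      (𝓝 (F (1 + w) / F 1)) := by
    intro w
    refine ((hF (1 + w)).div (hF 1) hF1).congr fun n => ?_
    rw [Pi.div_apply, hprod n w, mul_div_cancel_left₀ _ (hP1 n)]
  set σ : ℕ → ℝ := fun n => ∑ j ∈ range (d n), γ n j with hσ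
  have hσ0 : ∀ n, 0 ≤ σ n := fun n => sum_nonneg fun j _ => (hbd n j).1
  -- At w = 1 the convergent product dominates 1 + σ n.
  obtain ⟨M, hM⟩ : ∃ M, ∀ n, σ n ≤ M := by
    obtain ⟨M, hM⟩ := (hq 1).norm.bddAbove_range
    refine ⟨M, fun n => le_trans ?_ (hM ⟨n, rfl⟩)⟩
    have e : ∏ j ∈ range (d n), (1 + (γ n j : ℂ) * 1) =
        ((∏ j ∈ range (d n), (1 + γ n j) : ℝ) : ℂ) := by
      push_cast
      simp
    have h1 := one_add_sum_le_prod_one_add (fun j => (hbd n j).1) (d n)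
    simp only
    rw [e, Complex.norm_real, Real.norm_of_nonneg (by linarith [hσ0 n])]
    linarith
  have hM0 : 0 ≤ M := (hσ0 0).trans (hM 0)
  have hpart : ∀ n k, ∑ j ∈ range k, γ n j ≤ σ n := by
    intro n k
    rcases le_total k (d n) with h | h
    · exact sum_le_sum_of_subset_of_nonneg (range_mono h) fun j _ _ => (hbd n j).1
    · refine le_of_eq (sum_subset (range_mono h) fun j _ hj => hzero n j ?_).symm
      simpa using hj
  have hdecay : ∀ n j, γ n j ≤ M / (j + 1) := by
    intro n j
    rw [le_div_iff₀ (by positivity)]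
    have h1 : ∑ i ∈ range (j + 1), γ n j ≤ ∑ i ∈ range (j + 1), γ n i :=
      sum_le_sum fun i hi => hanti n (Nat.lt_succ_iff.1 (mem_range.1 hi))
    rw [sum_const, card_range, nsmul_eq_mul] at h1
    have h2 := (h1.trans (hpart n (j + 1))).trans (hM n)
    push_cast at h2
    linarith
  -- By Tychonoff, along one subsequence all the γ's and the sum σ converge simultaneously.
  have hcomp : IsCompact ((Set.univ.pi fun _ : ℕ => Set.Icc (0 : ℝ) 1) ×ˢ Set.Icc (0 : ℝ) M) :=
    (isCompact_univ_pi fun _ => isCompact_Icc).prod isCompact_Icc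
  obtain ⟨⟨γ', σ'⟩, hmem, φ, hφ, hlim⟩ := hcomp.tendsto_subseq (x := fun n => (γ n, σ n))
    fun n => ⟨fun j _ => hbd n j, hσ0 n, hM n⟩
  rw [nhds_prod_eq] at hlim
  have hγlim : ∀ j, Tendsto (fun n => γ (φ n) j) atTop (𝓝 (γ' j)) := by
    have := hlim.fst
    rw [tendsto_pi_nhds] at this
    exact this
  have hσlim : Tendsto (fun n => σ (φ n)) atTop (𝓝 σ') := hlim.snd
  have hbd' : ∀ j, 0 ≤ γ' j ∧ γ' j ≤ 1 := fun j => hmem.1 j trivial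
  have hanti' : Antitone γ' := fun i j hij =>
    le_of_tendsto_of_tendsto' (hγlim j) (hγlim i) fun n => hanti _ hij
  have hpart' : ∀ k, ∑ j ∈ range k, γ' j ≤ σ' := fun k =>
    le_of_tendsto_of_tendsto' (tendsto_finsetSum _ fun j _ => hγlim j) hσlim
      fun n => hpart _ k
  have hsum : Summable γ' := summable_of_sum_range_le (fun j => (hbd' j).1) hpart'
  have htsum : ∑' j, γ' j ≤ σ' := hsum.tsum_le_of_sum_range_le hpart'
  -- The exponent is the mass lost in the limit, carried by ever more numerous and ever smaller γ's.
  refine ⟨σ' - ∑' j, γ' j, γ', by linarith, hanti', hbd', hsum, fun w => ?_⟩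
  have hdom : Summable fun j : ℕ => (M / ((j : ℝ) + 1)) ^ 2 * (‖w‖ ^ 2 * Real.exp (2 * ‖w‖)) := by
    refine Summable.mul_right _ ?_
    have h1 := (summable_nat_add_iff 1).2 (Real.summable_one_div_nat_pow.2 one_lt_two)
    refine (h1.mul_left (M ^ 2)).congr fun j => ?_
    push_cast
    rw [div_pow]
    ring
  have hlimprod := tendsto_tprod_one_add_of_dominated_convergence (𝓕 := atTop)
    (f := fun n j => (1 + (γ (φ n) j : ℂ) * w) * Complex.exp (-((γ (φ n) j : ℂ) * w)) - 1)
    (g := fun j => (1 + (γ' j : ℂ) * w) * Complex.exp (-((γ' j : ℂ) * w)) - 1)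
    hdom (fun j => by
      have hc : Continuous fun x : ℝ => (1 + (x : ℂ) * w) * Complex.exp (-((x : ℂ) * w)) - 1 := by
        fun_prop
      exact (hc.tendsto (γ' j)).comp (hγlim j))
    (Eventually.of_forall fun n j => by
      refine (norm_one_add_mul_exp_neg_sub_one_le (hbd _ j).1 (hbd _ j).2 w).trans ?_
      have := (hbd (φ n) j).1
      have := hdecay (φ n) j
      gcongr)
  simp only [add_sub_cancel] at hlimprod
  have hfin : ∀ n, ∏' j, (1 + (γ n j : ℂ) * w) * Complex.exp (-((γ n j : ℂ) * w)) =
      (∏ j ∈ range (d n), (1 + (γ n j : ℂ) * w)) * Complex.exp (-((σ n : ℂ) * w)) := by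
    intro n
    rw [tprod_eq_prod (s := range (d n)) fun j hj => by
      rw [hzero n j (by simpa using hj)]; simp]
    rw [prod_mul_distrib, ← Complex.exp_sum, hσ]
    push_cast
    rw [sum_neg_distrib, sum_mul]
  have hlim2 : Tendsto (fun n => ∏' j, (1 + (γ (φ n) j : ℂ) * w) *
      Complex.exp (-((γ (φ n) j : ℂ) * w))) atTop
      (𝓝 (F (1 + w) / F 1 * Complex.exp (-((σ' : ℂ) * w)))) := by
    simp only [hfin]
    have hc : Continuous fun x : ℝ => Complex.exp (-((x : ℂ) * w)) := by fun_prop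
    exact ((hq w).comp hφ.tendsto_atTop).mul ((hc.tendsto σ').comp hσlim)
  have heq := tendsto_nhds_unique hlim2 hlimprod
  have hsumw : HasSum (fun j => -((γ' j : ℂ) * w)) (-(((∑' j, γ' j : ℝ) : ℂ) * w)) :=
    ((Complex.hasSum_ofReal.2 hsum.hasSum).mul_right w).neg
  have hmexp : HasProd (fun j => Complex.exp (-((γ' j : ℂ) * w)))
      (Complex.exp (-(((∑' j, γ' j : ℝ) : ℂ) * w))) := hsumw.cexp
  have hmul1 : Multipliable fun j => 1 + (γ' j : ℂ) * w := by
    refine multipliable_one_add_of_summable ?_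
    refine (hsum.mul_right ‖w‖).congr fun j => ?_
    rw [norm_mul, Complex.norm_real, Real.norm_of_nonneg (hbd' j).1]
  have hsplit : ∏' j, (1 + (γ' j : ℂ) * w) * Complex.exp (-((γ' j : ℂ) * w)) =
      (∏' j, (1 + (γ' j : ℂ) * w)) * Complex.exp (-(((∑' j, γ' j : ℝ) : ℂ) * w)) := by
    rw [hmul1.tprod_mul hmexp.multipliable, hmexp.tprod_eq]
  rw [hsplit] at heq
  have e1 : F (1 + w) = F 1 * (F (1 + w) / F 1 * Complex.exp (-((σ' : ℂ) * w))) *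
      Complex.exp ((σ' : ℂ) * w) := by
    have : Complex.exp (-((σ' : ℂ) * w)) * Complex.exp ((σ' : ℂ) * w) = 1 := by
      rw [← Complex.exp_add]; simp
    rw [mul_assoc, mul_assoc, this, mul_one, mul_div_cancel₀ _ hF1]
  rw [e1, heq]
  have e2 : Complex.exp (((σ' - ∑' j, γ' j : ℝ) : ℂ) * w) =
      Complex.exp (-(((∑' j, γ' j : ℝ) : ℂ) * w)) * Complex.exp ((σ' : ℂ) * w) := by
    rw [← Complex.exp_add]
    congr 1
    push_cast
    ring
  rw [e2]
  ring

/-- On the positive axis the product cannot compensate exponential growth. -/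
theorem one_le_norm_tprod {γ : ℕ → ℝ} (hγ : ∀ j, 0 ≤ γ j) (hs : Summable γ) {x : ℝ} (hx : 0 ≤ x) :
    1 ≤ ‖∏' j : ℕ, (1 + (γ j : ℂ) * (x : ℂ))‖ := by
  have hmul : Multipliable fun j => 1 + (γ j : ℂ) * (x : ℂ) := by
    refine multipliable_one_add_of_summable ((hs.mul_right x).congr fun j => ?_)
    rw [norm_mul, Complex.norm_real, Complex.norm_real, Real.norm_of_nonneg (hγ j),
      Real.norm_of_nonneg hx]
  refine ge_of_tendsto' hmul.hasProd.tendsto_prod_nat.norm fun n => ?_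
  have e : ∏ j ∈ range n, (1 + (γ j : ℂ) * (x : ℂ)) =
      ((∏ j ∈ range n, (1 + γ j * x) : ℝ) : ℂ) := by push_cast; rfl
  have h1 : 1 ≤ ∏ j ∈ range n, (1 + γ j * x) := by
    have := one_add_sum_le_prod_one_add (γ := fun j => γ j * x)
      (fun j => mul_nonneg (hγ j) hx) n
    have h2 : 0 ≤ ∑ j ∈ range n, γ j * x := sum_nonneg fun j _ => mul_nonneg (hγ j) hx
    linarith
  rw [e, Complex.norm_real, Real.norm_of_nonneg (by linarith)]
  exact h1

/-- The products expanded at `1` are Laguerre products. -/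
theorem exists_laguerre_product {γ : ℕ → ℝ} (hanti : Antitone γ) (hγ : ∀ j, 0 ≤ γ j ∧ γ j ≤ 1)
    (hs : Summable γ) : ∃ (C : ℂ) (l : ℕ) (β : ℕ → ℝ), Antitone β ∧ (∀ j, 0 ≤ β j) ∧ Summable β ∧
      ∀ z : ℂ, ∏' j : ℕ, (1 + (γ j : ℂ) * (z - 1)) =
        C * z ^ l * ∏' j : ℕ, (1 + (β j : ℂ) * z) := by
  have hex : ∃ j, γ j < 1 := (hs.tendsto_atTop_zero.eventually_lt_const one_pos).exists
  classical
  -- The first l values of γ, equal to 1, are the roots at the origin; monotonicity keeps all later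
  -- ones at most γ l < 1.
  set l := Nat.find hex with hl
  have hl1 : γ l < 1 := Nat.find_spec hex
  have hlt : ∀ j, j < l → γ j = 1 := fun j hj =>
    le_antisymm (hγ j).2 (not_lt.1 (Nat.find_min hex hj))
  have hge : ∀ j, γ (j + l) ≤ γ l := fun j => hanti (Nat.le_add_left l j)
  have hpos : ∀ j, 0 < 1 - γ (j + l) := fun j => by linarith [hge j]
  have hsl : Summable fun j => γ (j + l) := (summable_nat_add_iff l).2 hs
  -- From 1 + γ(z - 1) = (1 - γ)(1 + βz).
  set β : ℕ → ℝ := fun j => γ (j + l) / (1 - γ (j + l)) with hβ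
  have hβ0 : ∀ j, 0 ≤ β j := fun j => div_nonneg (hγ _).1 (hpos j).le
  have hβs : Summable β := by
    refine Summable.of_nonneg_of_le hβ0 (fun j => ?_) (hsl.mul_right (1 - γ l)⁻¹)
    simp only [hβ, div_eq_mul_inv]
    have h1 := (hγ (j + l)).1
    have h2 : 0 < 1 - γ l := by linarith
    have h3 := hge j
    gcongr
  refine ⟨∏' j : ℕ, (1 + (-γ (j + l) : ℂ)), l, β, fun i j hij => ?_, hβ0, hβs, fun z => ?_⟩
  · have h1 : γ (j + l) ≤ γ (i + l) := hanti (by omega)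
    have h2 := (hγ (j + l)).1
    have h3 := hpos i
    simp only [hβ]
    gcongr
    exact h2.trans h1
  · have hm1 : Multipliable fun j : ℕ => 1 + (-γ (j + l) : ℂ) := by
      refine multipliable_one_add_of_summable (hsl.congr fun j => ?_)
      rw [norm_neg, Complex.norm_real, Real.norm_of_nonneg (hγ _).1]
    have hm2 : Multipliable fun j : ℕ => 1 + (β j : ℂ) * z := by
      refine multipliable_one_add_of_summable ((hβs.mul_right ‖z‖).congr fun j => ?_)
      rw [norm_mul, Complex.norm_real, Real.norm_of_nonneg (hβ0 j)]
    have hterm : ∀ j, 1 + (γ (j + l) : ℂ) * (z - 1) =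
        (1 + (-γ (j + l) : ℂ)) * (1 + (β j : ℂ) * z) := by
      intro j
      have h1 : (1 : ℂ) - (γ (j + l) : ℂ) ≠ 0 := by exact_mod_cast (hpos j).ne'
      simp only [hβ]
      push_cast
      field_simp
      ring
    have hm3 : Multipliable fun j : ℕ => 1 + (γ (j + l) : ℂ) * (z - 1) := by
      simp only [hterm]
      exact hm1.mul hm2
    rw [← hm3.prod_mul_tprod_nat_mul' (f := fun j => 1 + (γ j : ℂ) * (z - 1))]
    have hfirst : ∏ j ∈ range l, (1 + (γ j : ℂ) * (z - 1)) = z ^ l := by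
      rw [prod_congr rfl fun j hj => by rw [hlt j (mem_range.1 hj)]]
      simp
    rw [hfirst]
    simp only [hterm]
    rw [hm1.tprod_mul hm2]
    ring

/-- If α > 0, the values at 1 + x with x ≥ 0 are at least ‖F 1‖ e^{αx}, against the bound of type
α/2 that membership in `spaceA 0` provides. -/
theorem hasLaguerreRep_zero_of_tendsto {P : ℕ → Polynomial ℂ} (hP : ∀ n, NonposRooted (P n))
    {F : ℂ → ℂ} (hF : ∀ z, Tendsto (fun n => (P n).eval z) atTop (𝓝 (F z))) (hF1 : F 1 ≠ 0)
    (hFA : F ∈ spaceA 0) : HasLaguerreRep 0 F := by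
  obtain ⟨α, γ, hα, hanti, hγ, hs, hrep⟩ := exists_factorization_of_tendsto hP hF hF1
  have hα0 : α = 0 := by
    by_contra hne
    have hαpos : 0 < α := lt_of_le_of_ne hα (Ne.symm hne)
    obtain ⟨K, hK⟩ := exists_geomBound_of_mem_spaceA le_rfl (half_pos hαpos) hFA
    have hle : ∀ x : ℝ, 0 ≤ x → ‖F 1‖ * Real.exp (α / 2 * x) ≤ K * Real.exp (α / 2) := by
      intro x hx
      have h1 := norm_le_of_geomBound (differentiable_of_mem_spaceA hFA) hK (1 + (x : ℂ))
      have h2 : ‖(1 : ℂ) + (x : ℂ)‖ = 1 + x := by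
        rw [← Complex.ofReal_one, ← Complex.ofReal_add, Complex.norm_real,
          Real.norm_of_nonneg (by positivity)]
      rw [h2, hrep, norm_mul, norm_mul, ← Complex.ofReal_mul, ← Complex.ofReal_exp,
        Complex.norm_real, Real.norm_of_nonneg (Real.exp_pos _).le] at h1
      have h3 := one_le_norm_tprod (fun j => (hγ j).1) hs hx
      have h4 : ‖F 1‖ * (Real.exp (α * x) * 1) ≤ K * Real.exp (α / 2 * (1 + x)) :=
        le_trans (by gcongr) h1
      have e1 : Real.exp (α * x) = Real.exp (α / 2 * x) * Real.exp (α / 2 * x) := by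
        rw [← Real.exp_add]; congr 1; ring
      have e2 : Real.exp (α / 2 * (1 + x)) = Real.exp (α / 2) * Real.exp (α / 2 * x) := by
        rw [← Real.exp_add]; congr 1; ring
      rw [e1, e2, mul_one, ← mul_assoc, ← mul_assoc] at h4
      exact le_of_mul_le_mul_right h4 (Real.exp_pos _)
    have htend : Tendsto (fun x : ℝ => ‖F 1‖ * Real.exp (α / 2 * x)) atTop atTop :=
      (Real.tendsto_exp_atTop.comp (tendsto_id.const_mul_atTop (half_pos hαpos))).const_mul_atTop
        (norm_pos_iff.2 hF1)
    obtain ⟨x, hx1, hx2⟩ := ((htend.eventually_gt_atTop (K * Real.exp (α / 2))).and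
      (eventually_ge_atTop 0)).exists
    exact absurd (hle x hx2) (not_le.2 hx1)
  obtain ⟨C, l, β, hβa, hβ0, hβs, hβ⟩ := exists_laguerre_product hanti hγ hs
  refine ⟨F 1 * C, l, β, hβa, hβ0, hβs, fun z => ?_⟩
  have h := hrep (z - 1)
  rw [add_sub_cancel, hα0, hβ] at h
  rw [h]
  simp
  ring

/-! ### Euler's approximation of exp(τ Δ_θ) -/

theorem Polynomial.hasSum_coeff_mul_pow (p : Polynomial ℂ) (z : ℂ) :
    HasSum (fun j => p.coeff j * z ^ j) (p.eval z) := by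
  rw [Polynomial.eval_eq_sum_range]
  refine hasSum_sum_of_ne_finset_zero fun j hj => ?_
  rw [Polynomial.coeff_eq_zero_of_natDegree_lt (by simpa using hj), zero_mul]

theorem coeff_deltaPoly (θ : ℝ) (p : Polynomial ℂ) (j : ℕ) :
    (deltaPoly θ p).coeff j = (((j + 1) * (θ + j) : ℝ) : ℂ) * p.coeff (j + 1) := by
  rw [deltaPoly_apply, Polynomial.coeff_add, Polynomial.coeff_smul, Polynomial.coeff_derivative,
    smul_eq_mul]
  cases j with
  | zero => simp
  | succ j =>
    rw [Polynomial.coeff_X_mul, Polynomial.coeff_derivative, Polynomial.coeff_derivative]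
    push_cast
    ring

theorem coeff_deltaPoly_pow (θ : ℝ) (p : Polynomial ℂ) (j k : ℕ) :
    ((deltaPoly θ ^ k) p).coeff j =
      (((j + k).factorial / (j.factorial : ℝ) * poch (θ + j) k : ℝ) : ℂ) * p.coeff (j + k) := by
  induction k generalizing j with
  | zero =>
    have : (j.factorial : ℂ) ≠ 0 := Nat.cast_ne_zero.2 (Nat.factorial_ne_zero j)
    simp [div_self this]
  | succ k ih =>
    have e : j + (k + 1) = (j + 1) + k := by ring
    rw [pow_succ', Module.End.mul_apply, coeff_deltaPoly, ih, e, ← mul_assoc, ← Complex.ofReal_mul]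
    congr 2
    have hx : θ + ((j + 1 : ℕ) : ℝ) = θ + j + 1 := by push_cast; ring
    rw [poch_succ', hx, Nat.factorial_succ j]
    have : (j.factorial : ℝ) ≠ 0 := Nat.cast_ne_zero.2 (Nat.factorial_ne_zero j)
    push_cast
    field_simp

theorem eval_one_add_pow (θ : ℝ) (a : ℂ) (n : ℕ) (p : Polynomial ℂ) (z : ℂ) :
    (((1 + a • deltaPoly θ) ^ n : Module.End ℂ (Polynomial ℂ)) p).eval z =
      ∑ k ∈ range (n + 1), (n.choose k : ℂ) * a ^ k * ((deltaPoly θ ^ k) p).eval z := by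
  rw [add_comm, (Commute.one_right (a • deltaPoly θ)).add_pow, LinearMap.sum_apply,
    Polynomial.eval_finsetSum]
  refine sum_congr rfl fun k _ => ?_
  rw [one_pow, mul_one, Module.End.mul_apply, Module.End.natCast_apply, smul_pow,
    LinearMap.smul_apply, map_nsmul, Polynomial.eval_smul, Polynomial.eval_smul, smul_eq_mul,
    nsmul_eq_mul]
  ring

/-- The ratio `n (n - 1) ⋯ (n - k + 1) / n ^ k`. -/
noncomputable def fallRatio (n k : ℕ) : ℝ := (n.descFactorial k : ℝ) / (n : ℝ) ^ k

theorem fallRatio_nonneg (n k : ℕ) : 0 ≤ fallRatio n k := by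
  unfold fallRatio
  positivity

theorem fallRatio_le_one (n k : ℕ) : fallRatio n k ≤ 1 :=
  div_le_one_of_le₀ (by exact_mod_cast Nat.descFactorial_le_pow n k) (by positivity)

theorem tendsto_fallRatio (k : ℕ) : Tendsto (fun n => fallRatio n k) atTop (𝓝 1) := by
  have h := isEquivalent_descFactorial k
  rwa [Asymptotics.isEquivalent_iff_tendsto_one] at h
  filter_upwards [eventually_gt_atTop 0] with n hn
  positivity

theorem heatTerm_eq_mul (θ : ℝ) (a : ℕ → ℂ) (t z : ℂ) (p : ℕ × ℕ) :
    heatTerm θ a t z p = a (p.1 + p.2) * heatTerm θ (fun _ => 1) t z p := by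
  simp only [heatTerm]
  ring

theorem choose_mul_pow_mul_coeff (θ : ℝ) (n : ℕ) (p : Polynomial ℂ) (τ : ℝ) (z : ℂ) (j k : ℕ) :
    (n.choose k : ℂ) * ((τ / n : ℝ) : ℂ) ^ k * (((deltaPoly θ ^ k) p).coeff j * z ^ j) =
      (fallRatio n k : ℂ) * heatTerm θ (fun m => (m.factorial : ℂ) * p.coeff m) τ z (j, k) := by
  have h1 : (j.factorial : ℂ) ≠ 0 := Nat.cast_ne_zero.2 (Nat.factorial_ne_zero _)
  have h2 : (k.factorial : ℂ) ≠ 0 := Nat.cast_ne_zero.2 (Nat.factorial_ne_zero _)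
  have h3 : (n.descFactorial k : ℂ) = (k.factorial : ℂ) * (n.choose k : ℂ) := by
    exact_mod_cast Nat.descFactorial_eq_factorial_mul_choose n k
  rw [coeff_deltaPoly_pow, heatTerm, fallRatio]
  push_cast
  rw [h3, div_pow]
  field_simp

/-- Euler's approximation of `exp (τ Δ_θ)` along polynomials with dominated coefficients. -/
theorem tendsto_eval_one_add_pow {θ : ℝ} (hθ : 0 ≤ θ) {a : ℕ → ℂ} (ha : MinType a) {τ : ℝ}
    (hτ : 0 ≤ τ) {Q : ℕ → Polynomial ℂ} (hQ : ∀ n m, ‖(m.factorial : ℂ) * (Q n).coeff m‖ ≤ ‖a m‖)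
    (hlim : ∀ m, Tendsto (fun n => (m.factorial : ℂ) * (Q n).coeff m) atTop (𝓝 (a m))) (z : ℂ) :
    Tendsto (fun n : ℕ => (((1 + ((τ / n : ℝ) : ℂ) • deltaPoly θ) ^ n :
      Module.End ℂ (Polynomial ℂ)) (Q n)).eval z) atTop (𝓝 (∑' p, heatTerm θ a τ z p)) := by
  obtain ⟨K, hK⟩ := ha (1 / (τ + 1)) (by positivity)
  have hlt : 1 / (τ + 1) * ‖(τ : ℂ)‖ < 1 := by
    rw [Complex.norm_real, Real.norm_of_nonneg hτ, one_div_mul_eq_div, div_lt_one (by positivity)]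
    linarith
  have hbs := hK.summable_norm_heatTerm hθ (by positivity) hlt z
  -- By C(n, k)(τ/n)^k = `fallRatio n k` · τ^k / k!, the binomial expansion consists of damped terms
  -- of the exponential series, so that series itself is the majorant.
  set T : ℕ → ℕ × ℕ → ℂ := fun n p => (fallRatio n p.2 : ℂ) *
    heatTerm θ (fun m => (m.factorial : ℂ) * (Q n).coeff m) τ z p with hT
  have hTb : ∀ n p, ‖T n p‖ ≤ ‖heatTerm θ a τ z p‖ := by
    intro n p
    simp only [hT]
    rw [heatTerm_eq_mul θ a, heatTerm_eq_mul θ (fun m => (m.factorial : ℂ) * (Q n).coeff m),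
      norm_mul, norm_mul, norm_mul (a _), Complex.norm_real,
      Real.norm_of_nonneg (fallRatio_nonneg _ _)]
    refine (mul_le_of_le_one_left (by positivity) (fallRatio_le_one _ _)).trans ?_
    exact mul_le_mul_of_nonneg_right (hQ n _) (norm_nonneg _)
  have hTlim : ∀ p, Tendsto (fun n => T n p) atTop (𝓝 (heatTerm θ a τ z p)) := by
    intro p
    have h1 : Tendsto (fun n => (fallRatio n p.2 : ℂ)) atTop (𝓝 ((1 : ℝ) : ℂ)) :=
      (Complex.continuous_ofReal.tendsto 1).comp (tendsto_fallRatio p.2)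
    have h2 := h1.mul ((hlim (p.1 + p.2)).mul_const (heatTerm θ (fun _ => 1) τ z p))
    rw [Complex.ofReal_one, one_mul, ← heatTerm_eq_mul] at h2
    refine h2.congr fun n => ?_
    simp only [hT]
    rw [heatTerm_eq_mul θ (fun m => (m.factorial : ℂ) * (Q n).coeff m)]
  refine (tendsto_tsum_of_dominated_convergence hbs hTlim
    (Eventually.of_forall fun n p => hTb n p)).congr fun n => ?_
  have hsum : Summable (T n) :=
    Summable.of_norm (Summable.of_nonneg_of_le (fun p => norm_nonneg (T n p)) (hTb n) hbs)
  have hswap := (Equiv.prodComm ℕ ℕ).hasSum_iff.2 hsum.hasSum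
  have hfib : HasSum (fun k => (n.choose k : ℂ) * ((τ / n : ℝ) : ℂ) ^ k *
      ((deltaPoly θ ^ k) (Q n)).eval z) (∑' p, T n p) := by
    refine hswap.prod_fiberwise fun k => ?_
    refine ((Polynomial.hasSum_coeff_mul_pow ((deltaPoly θ ^ k) (Q n)) z).mul_left
      ((n.choose k : ℂ) * ((τ / n : ℝ) : ℂ) ^ k)).congr_fun fun j => ?_
    rw [choose_mul_pow_mul_coeff]
    rfl
  rw [eval_one_add_pow]
  refine hfib.unique (hasSum_sum_of_ne_finset_zero fun k hk => ?_)
  rw [Nat.choose_eq_zero_of_lt (by simpa using hk)]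
  simp

/-! ### Coefficients of Laguerre products -/

/-- The partial products `X ^ l * ∏_{j < n} (1 + β_j X)`. -/
noncomputable def partialPoly (l : ℕ) (β : ℕ → ℝ) (n : ℕ) : Polynomial ℝ :=
  Polynomial.X ^ l * ∏ j ∈ range n, (1 + Polynomial.C (β j) * Polynomial.X)

theorem partialPoly_succ (l : ℕ) (β : ℕ → ℝ) (n : ℕ) : partialPoly l β (n + 1) =
    partialPoly l β n + Polynomial.C (β n) * (Polynomial.X * partialPoly l β n) := by
  rw [partialPoly, prod_range_succ, partialPoly]
  ring

theorem coeff_partialPoly_nonneg (l : ℕ) {β : ℕ → ℝ} (hβ : ∀ j, 0 ≤ β j) (n m : ℕ) :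
    0 ≤ (partialPoly l β n).coeff m := by
  induction n generalizing m with
  | zero =>
    rw [partialPoly, range_zero, prod_empty, mul_one, Polynomial.coeff_X_pow]
    split_ifs <;> norm_num
  | succ n ih =>
    rw [partialPoly_succ, Polynomial.coeff_add, Polynomial.coeff_C_mul]
    have h1 : 0 ≤ (Polynomial.X * partialPoly l β n).coeff m := by
      cases m with
      | zero => simp
      | succ m => rw [Polynomial.coeff_X_mul]; exact ih m
    have := ih m
    have := hβ n
    positivity

theorem monotone_coeff_partialPoly (l : ℕ) {β : ℕ → ℝ} (hβ : ∀ j, 0 ≤ β j) (m : ℕ) :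
    Monotone fun n => (partialPoly l β n).coeff m := by
  refine monotone_nat_of_le_succ fun n => ?_
  rw [partialPoly_succ, Polynomial.coeff_add, Polynomial.coeff_C_mul, le_add_iff_nonneg_right]
  refine mul_nonneg (hβ n) ?_
  cases m with
  | zero => simp
  | succ m => rw [Polynomial.coeff_X_mul]; exact coeff_partialPoly_nonneg l hβ n m

/-- With nonnegative coefficients, a single term is at most the value at R, and 1 + x ≤ e^x bounds
that value independently of n. -/
theorem coeff_partialPoly_mul_pow_le (l : ℕ) {β : ℕ → ℝ} (hβ : ∀ j, 0 ≤ β j) (hs : Summable β)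
    {R : ℝ} (hR : 0 ≤ R) (n m : ℕ) :
    (partialPoly l β n).coeff m * R ^ m ≤ R ^ l * Real.exp (R * ∑' j, β j) := by
  have h1 : (partialPoly l β n).coeff m * R ^ m ≤ (partialPoly l β n).eval R := by
    rw [Polynomial.eval_eq_sum_range]
    by_cases hm : m ∈ range ((partialPoly l β n).natDegree + 1)
    · exact single_le_sum (f := fun i => (partialPoly l β n).coeff i * R ^ i)
        (fun i _ => mul_nonneg (coeff_partialPoly_nonneg l hβ n i) (by positivity)) hm
    · rw [Polynomial.coeff_eq_zero_of_natDegree_lt (by simpa using hm), zero_mul]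
      exact sum_nonneg fun i _ => mul_nonneg (coeff_partialPoly_nonneg l hβ n i) (by positivity)
  refine h1.trans ?_
  rw [partialPoly, Polynomial.eval_mul, Polynomial.eval_pow, Polynomial.eval_X,
    Polynomial.eval_prod]
  gcongr
  simp only [Polynomial.eval_add, Polynomial.eval_one, Polynomial.eval_mul, Polynomial.eval_C,
    Polynomial.eval_X]
  calc ∏ j ∈ range n, (1 + β j * R) ≤ ∏ j ∈ range n, Real.exp (β j * R) := by
        refine prod_le_prod (fun j _ => ?_) fun j _ => ?_
        · have := hβ j
          positivity
        · rw [add_comm]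
          exact Real.add_one_le_exp _
    _ = Real.exp (∑ j ∈ range n, β j * R) := (Real.exp_sum _ _).symm
    _ ≤ _ := by
      refine Real.exp_le_exp.2 ?_
      rw [← sum_mul, mul_comm]
      exact mul_le_mul_of_nonneg_left (hs.sum_le_tsum _ fun j _ => hβ j) hR

/-- The power series coefficients of `z ^ l * ∏ (1 + β_j z)`. -/
theorem exists_coeff_laguerre (l : ℕ) {β : ℕ → ℝ} (hβ : ∀ j, 0 ≤ β j) (hs : Summable β) :
    ∃ e : ℕ → ℝ, (∀ m, Tendsto (fun n => (partialPoly l β n).coeff m) atTop (𝓝 (e m))) ∧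
      (∀ n m, (partialPoly l β n).coeff m ≤ e m) ∧
      EgfSummable (fun m => ((m.factorial * e m : ℝ) : ℂ)) ∧
      ∀ z : ℂ, egf (fun m => ((m.factorial * e m : ℝ) : ℂ)) z =
        z ^ l * ∏' j, (1 + (β j : ℂ) * z) := by
  have hbdd : ∀ m, BddAbove (Set.range fun n => (partialPoly l β n).coeff m) := by
    intro m
    refine ⟨1 ^ l * Real.exp (1 * ∑' j, β j), ?_⟩
    rintro _ ⟨n, rfl⟩
    simpa using coeff_partialPoly_mul_pow_le l hβ hs zero_le_one n m
  set e : ℕ → ℝ := fun m => ⨆ n, (partialPoly l β n).coeff m with he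
  have hlim : ∀ m, Tendsto (fun n => (partialPoly l β n).coeff m) atTop (𝓝 (e m)) :=
    fun m => tendsto_atTop_ciSup (monotone_coeff_partialPoly l hβ m) (hbdd m)
  have hle : ∀ n m, (partialPoly l β n).coeff m ≤ e m := fun n m => le_ciSup (hbdd m) n
  have he0 : ∀ m, 0 ≤ e m := fun m => (coeff_partialPoly_nonneg l hβ 0 m).trans (hle 0 m)
  have heb : ∀ R : ℝ, 0 ≤ R → ∀ m, e m * R ^ m ≤ R ^ l * Real.exp (R * ∑' j, β j) :=
    fun R hR m => le_of_tendsto' ((hlim m).mul_const _)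
      fun n => coeff_partialPoly_mul_pow_le l hβ hs hR n m
  have hesum : ∀ R : ℝ, 0 ≤ R → Summable fun m => e m * R ^ m := by
    intro R hR
    refine Summable.of_nonneg_of_le (fun m => mul_nonneg (he0 m) (by positivity)) (fun m => ?_)
      -- The bound is used at radius 2R, so that a factor 2^{-m} is left at radius R.
      (summable_geometric_two.mul_left ((2 * R) ^ l * Real.exp ((2 * R) * ∑' j, β j)))
    have h1 := heb (2 * R) (by positivity) m
    calc e m * R ^ m = e m * (2 * R) ^ m * (1 / 2) ^ m := by
          rw [mul_assoc, ← mul_pow]; congr 2; ring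
      _ ≤ _ := by gcongr
  have hfac : ∀ m : ℕ, (m.factorial : ℂ) ≠ 0 := fun m =>
    Nat.cast_ne_zero.2 (Nat.factorial_ne_zero _)
  have hterm : ∀ (m : ℕ) (z : ℂ), ((m.factorial * e m : ℝ) : ℂ) * z ^ m / (m.factorial : ℂ) =
      (e m : ℂ) * z ^ m := by
    intro m z
    have := hfac m
    push_cast
    field_simp
  refine ⟨e, hlim, hle, fun R hR => ?_, fun z => ?_⟩
  · refine (hesum R hR).congr fun m => ?_
    have h2 : (m.factorial : ℝ) ≠ 0 := Nat.cast_ne_zero.2 (Nat.factorial_ne_zero _)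
    have h3 := he0 m
    rw [Complex.norm_real, Real.norm_of_nonneg (by positivity)]
    field_simp
  · have hm : Multipliable fun j => 1 + (β j : ℂ) * z := by
      refine multipliable_one_add_of_summable ((hs.mul_right ‖z‖).congr fun j => ?_)
      rw [norm_mul, Complex.norm_real, Real.norm_of_nonneg (hβ j)]
    have h1 := hm.hasProd.tendsto_prod_nat.const_mul (z ^ l)
    have h2 : Tendsto (fun n => ∑' m, ((partialPoly l β n).coeff m : ℂ) * z ^ m) atTop
        (𝓝 (∑' m, (e m : ℂ) * z ^ m)) := by
      refine tendsto_tsum_of_dominated_convergence (hesum ‖z‖ (norm_nonneg z)) (fun m => ?_)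
        (Eventually.of_forall fun n m => ?_)
      · exact ((Complex.continuous_ofReal.tendsto _).comp (hlim m)).mul_const _
      · rw [norm_mul, Complex.norm_real, norm_pow,
          Real.norm_of_nonneg (coeff_partialPoly_nonneg l hβ n m)]
        gcongr
        exact hle n m
    have h3 : ∀ n, ∑' m, ((partialPoly l β n).coeff m : ℂ) * z ^ m =
        z ^ l * ∏ j ∈ range n, (1 + (β j : ℂ) * z) := by
      intro n
      have h4 := (Polynomial.hasSum_coeff_mul_pow
        ((partialPoly l β n).map Complex.ofRealHom) z).tsum_eq
      simp only [Polynomial.coeff_map, Complex.ofRealHom_eq_coe] at h4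
      rw [h4, partialPoly]
      simp [Polynomial.map_prod, Polynomial.eval_prod]
    simp only [h3] at h2
    rw [← tendsto_nhds_unique h2 h1]
    exact tsum_congr fun m => hterm m z

theorem nonposRooted_partialPoly {c : ℂ} (hc : c ≠ 0) (l : ℕ) {β : ℕ → ℝ} (hβ : ∀ j, 0 ≤ β j)
    (n : ℕ) : NonposRooted (Polynomial.C c * (partialPoly l β n).map Complex.ofRealHom) := by
  refine NonposRooted.of_eval_ne_zero fun z hz => ?_
  have hz0 : z ≠ 0 := by
    rintro rfl
    simp at hz
  have hfac : ∀ j, 1 + (β j : ℂ) * z ≠ 0 := by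
    intro j h
    have hre := congrArg Complex.re h
    have him := congrArg Complex.im h
    simp only [Complex.add_re, Complex.add_im, Complex.one_re, Complex.one_im,
      Complex.re_ofReal_mul, Complex.im_ofReal_mul, Complex.zero_re, Complex.zero_im,
      zero_add] at hre him
    rcases hz with hz | hz
    · have h0 : β j = 0 := (mul_eq_zero.1 him).resolve_right hz
      rw [h0] at hre
      norm_num at hre
    · have := mul_nonneg (hβ j) hz.le
      linarith
  have e : (Polynomial.C c * (partialPoly l β n).map Complex.ofRealHom).eval z =
      c * (z ^ l * ∏ j ∈ range n, (1 + (β j : ℂ) * z)) := by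
    simp [partialPoly, Polynomial.map_prod, Polynomial.eval_prod]
  rw [e]
  exact mul_ne_zero hc (mul_ne_zero (pow_ne_zero _ hz0) (prod_ne_zero_iff.2 fun j _ => hfac j))

/-- At z = 1 all terms are c times nonnegative reals, and the term (l, 0) is not zero. This makes 1
an admissible base point for the limit factorization. -/
theorem tsum_heatTerm_one_ne_zero {θ : ℝ} (hθ : 0 ≤ θ) {c : ℂ} (hc : c ≠ 0) {b : ℕ → ℝ}
    (hb : ∀ m, 0 ≤ b m) {l : ℕ} (hl : 0 < b l) {τ : ℝ} (hτ : 0 ≤ τ)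
    (hs : Summable (heatTerm θ (fun m => c * (b m : ℂ)) τ 1)) :
    ∑' p, heatTerm θ (fun m => c * (b m : ℂ)) τ 1 p ≠ 0 := by
  set r : ℕ × ℕ → ℝ := fun p => poch (θ + p.1) p.2 * b (p.1 + p.2) * τ ^ p.2 /
    (p.2.factorial : ℝ) * (1 / (p.1.factorial : ℝ)) with hr
  have hterm : ∀ p, heatTerm θ (fun m => c * (b m : ℂ)) τ 1 p = c * (r p : ℂ) := by
    intro p
    simp only [heatTerm, hr, one_pow]
    push_cast
    ring
  have hr0 : ∀ p, 0 ≤ r p := by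
    intro p
    have h1 := poch_nonneg (x := θ + p.1) (by positivity) p.2
    have h2 := hb (p.1 + p.2)
    simp only [hr]
    positivity
  have hs' := hs.congr fun p => hterm p
  have hsr : Summable r := Complex.summable_ofReal.1 ((summable_mul_left_iff hc).1 hs')
  rw [tsum_congr hterm]
  rw [tsum_mul_left, ← Complex.ofReal_tsum]
  refine mul_ne_zero hc (Complex.ofReal_ne_zero.2 (ne_of_gt ?_))
  refine hsr.tsum_pos hr0 (l, 0) ?_
  simp only [hr, poch_zero, pow_zero, add_zero, Nat.factorial_zero]
  positivity

theorem expDelta_of_eq_zero (θ t : ℝ) : expDelta θ t (fun _ => 0) = fun _ => 0 := by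
  funext z
  simp [expDelta, expDeltaIntegrand]

/-! ### Preservation of the Laguerre families and conclusion -/

/-- The operators `exp (τ Δ_θ)` preserve the Laguerre family. -/
theorem hasLaguerreRep_expDelta {θ : ℝ} (hθ : 0 ≤ θ) {h : ℂ → ℂ} (hh : h ∈ spaceA 0)
    (hL : HasLaguerreRep 0 h) {τ : ℝ} (hτ : 0 ≤ τ) : HasLaguerreRep 0 (expDelta θ τ h) := by
  obtain ⟨c, l, β, hanti, hβ, hs, hrep⟩ := hL
  -- The zero function is treated apart, since both the approximating polynomials and the value at 1
  -- must be nonzero.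
  rcases eq_or_ne c 0 with rfl | hc
  · have h0 : h = fun _ => 0 := funext fun z => by rw [hrep]; simp
    rw [h0, expDelta_of_eq_zero]
    exact ⟨0, l, β, hanti, hβ, hs, fun z => by simp⟩
  obtain ⟨e, hlim, hle, hes, hegf⟩ := exists_coeff_laguerre l hβ hs
  have ha := minType_of_mem_spaceA hh
  set b : ℕ → ℝ := fun m => m.factorial * e m with hb
  have he0 : ∀ m, 0 ≤ e m := fun m => (coeff_partialPoly_nonneg l hβ 0 m).trans (hle 0 m)
  have hcoef : (fun m => iteratedDeriv m h 0) = fun m => c * (b m : ℂ) := by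
    have e1 : h = egf fun m => c * (b m : ℂ) := by
      funext z
      rw [egf_const_mul, hegf, hrep, Complex.ofReal_zero, zero_mul, Complex.exp_zero]
      ring
    funext m
    conv_lhs => rw [e1]
    exact (hes.const_mul c).iteratedDeriv_zero m
  set Q : ℕ → Polynomial ℂ := fun n =>
    Polynomial.C c * (partialPoly l β n).map Complex.ofRealHom with hQ
  have hQc : ∀ n m, (m.factorial : ℂ) * (Q n).coeff m =
      c * ((m.factorial * (partialPoly l β n).coeff m : ℝ) : ℂ) := by
    intro n m
    simp only [hQ, Polynomial.coeff_C_mul, Polynomial.coeff_map, Complex.ofRealHom_eq_coe]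
    push_cast
    ring
  rw [hcoef] at ha
  have hF := tendsto_eval_one_add_pow hθ ha hτ (Q := Q)
    (fun n m => by
      rw [hQc, norm_mul, norm_mul, Complex.norm_real, Complex.norm_real,
        Real.norm_of_nonneg (mul_nonneg (by positivity) (coeff_partialPoly_nonneg l hβ n m)),
        Real.norm_of_nonneg (mul_nonneg (by positivity) (he0 m))]
      have := hle n m
      gcongr)
    (fun m => by
      simp only [hQc]
      exact ((Complex.continuous_ofReal.tendsto _).comp ((hlim m).const_mul _)).const_mul c)
  obtain ⟨K, hK⟩ := ha (1 / (τ + 1)) (by positivity)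
  have hlt : 1 / (τ + 1) * ‖(τ : ℂ)‖ < 1 := by
    rw [Complex.norm_real, Real.norm_of_nonneg hτ, one_div_mul_eq_div, div_lt_one (by positivity)]
    linarith
  have hval : ∀ z, ∑' p, heatTerm θ (fun m => c * (b m : ℂ)) τ z p = expDelta θ τ h z := by
    intro z
    rw [(hasSum_heatTerm_egf hθ (by positivity) hK hlt z).tsum_eq,
      expDelta_eq_egf_of_mem_spaceA_zero hθ hh hτ, hcoef]
  have hmem : expDelta θ τ h ∈ spaceA 0 :=
    expDelta_mem_spaceA hθ le_rfl hh (fun z => by simp) hτ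
  have hel : 0 < e l := by
    -- The empty partial product X^l already has coefficient 1 at l, and coefficients only increase.
    refine lt_of_lt_of_le ?_ (hle 0 l)
    simp [partialPoly]
  refine hasLaguerreRep_zero_of_tendsto
    (P := fun n : ℕ => ((1 + ((τ / n : ℝ) : ℂ) • deltaPoly θ) ^ n :
      Module.End ℂ (Polynomial ℂ)) (Q n))
    (fun n => (nonposRooted_partialPoly hc l hβ n).pow_deltaPoly hθ (by positivity) n)
    (fun z => ?_) ?_ hmem
  · rw [← hval]
    exact hF z
  · rw [← hval]
    exact tsum_heatTerm_one_ne_zero hθ hc (fun m => mul_nonneg (by positivity) (he0 m))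
      (l := l) (by positivity) hτ
      (hK.summable_norm_heatTerm hθ (by positivity) hlt 1).of_norm

theorem hasLaguerreRep_expDelta_exp_mul {θ ε t : ℝ} (hθ : 0 ≤ θ) (hε : 0 ≤ ε) (ht : 0 ≤ t)
    {g h : ℂ → ℂ} (hh : h ∈ spaceA 0) (hg : ∀ z : ℂ, g z = Complex.exp (-(ε : ℂ) * z) * h z)
    (hL : HasLaguerreRep 0 h) : HasLaguerreRep (-(ε * contr ε t)) (expDelta θ t g) := by
  have hA := contr_pos (ε := ε) (t := t) (by positivity)
  obtain ⟨C, l, β, hanti, hβ, hs, hrep⟩ :=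
    hasLaguerreRep_expDelta hθ hh hL (τ := t * contr ε t) (by positivity)
  set A := contr ε t
  refine ⟨((A ^ θ : ℝ) : ℂ) * C * ((A : ℂ) ^ 2) ^ l, l, fun j => A ^ 2 * β j,
    fun i j hij => mul_le_mul_of_nonneg_left (hanti hij) (by positivity),
    fun j => mul_nonneg (by positivity) (hβ j), hs.mul_left _, fun z => ?_⟩
  rw [expDelta_exp_mul hε ht hg, hrep, Complex.ofReal_zero, zero_mul, Complex.exp_zero]
  have e : ∀ j, (1 : ℂ) + (β j : ℂ) * ((A : ℂ) ^ 2 * z) = 1 + ((A ^ 2 * β j : ℝ) : ℂ) * z := by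
    intro j
    push_cast
    ring
  simp only [A] at e ⊢
  simp only [e, mul_pow]
  push_cast
  ring

theorem theorem5 (θ ε : ℝ) (hθ : 0 ≤ θ) (hε : 0 ≤ ε) (g h : ℂ → ℂ)
    (hh : h ∈ spaceA 0) (hg : ∀ z : ℂ, g z = Complex.exp (-(ε : ℂ) * z) * h z) :
    -- the integral is absolutely convergent
    (∀ t : ℝ, 0 < t → ∀ z : ℂ,
      MeasureTheory.IntegrableOn (expDeltaIntegrand θ g t z) (Set.Ioi (0 : ℝ))) ∧
    -- `f(t, ·) = exp(t Δ_θ) g` is the sum of its defining double series where that applies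
    (∀ t : ℝ, 0 ≤ t → t * ε < 1 → ∀ z : ℂ,
      HasSum (opSeriesTerm θ (fun w : ℂ => Complex.exp ((t : ℂ) * w)) g z) (expDelta θ t g z)) ∧
    -- `f(t, ·) ∈ A_ε`, the initial condition and the equation
    (∀ t : ℝ, 0 ≤ t → expDelta θ t g ∈ spaceA ε) ∧
    expDelta θ 0 g = g ∧
    (∀ t : ℝ, 0 ≤ t → ∀ z : ℂ,
      HasDerivWithinAt (fun τ : ℝ => expDelta θ τ g z)
        ((θ : ℂ) * deriv (expDelta θ t g) z + z * deriv (deriv (expDelta θ t g)) z)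
        (Set.Ici 0) t) ∧
    -- the derivative in `t` exists also in the topology of `A_ε`
    (∀ t : ℝ, 0 ≤ t → ∀ b : ℝ, ε < b →
      Filter.Tendsto
        (fun τ : ℝ => expTypeNorm b (fun z : ℂ =>
          (expDelta θ τ g z - expDelta θ t g z) / ((τ : ℂ) - (t : ℂ)) -
            deltaOp θ (expDelta θ t g) z))
        (nhdsWithin t (Set.Ici 0 \ {t})) (nhds 0)) ∧
    -- convergence to zero, uniformly on compact sets
    (0 < ε → (0 < θ ∨ g 0 = 0) → ∀ K : Set ℂ, IsCompact K →
      TendstoUniformlyOn (fun t : ℝ => expDelta θ t g) (fun _ => 0) Filter.atTop K) ∧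
    -- preservation of the Laguerre families
    (h ∈ familyLZero → ∀ t : ℝ, 0 ≤ t →
      (ε = 0 → expDelta θ t g ∈ familyLZero) ∧ (0 < ε → expDelta θ t g ∈ familyLMinus)) := by
  refine ⟨fun t ht z => integrableOn_expDeltaIntegrand hθ hε hh hg ht z, fun t ht htε z => ?_,
    fun t ht => expDelta_mem_spaceA hθ hε hh hg ht, ?_,
    fun t ht z => hasDerivWithinAt_expDelta hθ hε hh hg ht z,
    fun t ht b hb => tendsto_expTypeNorm_quot hθ hε hh hg ht hb,
    fun hε0 hor K hK => tendstoUniformlyOn_expDelta_zero hθ hε0 hh hg hor hK,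
    fun hL t ht => ⟨fun h0 => ?_, fun hpos => ?_⟩⟩
  · obtain ⟨b, hb, hbt⟩ : ∃ b, ε < b ∧ b * t < 1 := by
      -- Since tε < 1, there is room for a rate b > ε with bt < 1; the denominator contains t + 1 so
      -- that t = 0 is covered.
      refine ⟨ε + (1 - t * ε) / (2 * (t + 1)), ?_, ?_⟩
      · have : 0 < (1 - t * ε) / (2 * (t + 1)) := div_pos (by linarith) (by positivity)
        linarith
      · have h1 : (1 - t * ε) / (2 * (t + 1)) * t < 1 - t * ε := by
          rw [div_mul_eq_mul_div, div_lt_iff₀ (by positivity)]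
          nlinarith
        linarith
    obtain ⟨K, hK⟩ := exists_geomBound_exp_mul hε hb hh hg
    exact hasSum_opSeriesTerm_exp θ g (hasSum_heatTerm_expDelta hθ
      (differentiable_exp_mul (differentiable_of_mem_spaceA hh) hg) (hε.trans hb.le) hK ht hbt z)
  · funext z
    simp [expDelta]
  · have := hasLaguerreRep_expDelta_exp_mul hθ hε ht hh hg hL
    rw [h0, zero_mul, neg_zero] at this
    exact this
  · refine ⟨-(ε * contr ε t), ?_, hasLaguerreRep_expDelta_exp_mul hθ hε ht hh hg hL⟩
    exact neg_neg_of_pos (mul_pos hpos (contr_pos (by positivity)))
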